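/- Let $\mathcal C$ be an abelian category with a braided monoidal structure $(\otimes,\mathbf 1,\Psi)$ whose tensor product is bi-additive, and assume that $\mathcal C$ is $\otimes$-factor, i.e. the tensor product of two epimorphisms is an epimorphism and the tensor product of two monomorphisms is a monomorphism. Let $H$ be a Hopf algebra in $\mathcal C$ with multiplication $m$, unit $\eta$, comultiplication $\Delta$, counit $\varepsilon$ and antipode $S$. Assume that $S$ is an isomorphism and that $H$ is flat, i.e. the functor $H\otimes -$ is exact. *Definitions.* A Hopf bimodule over $H$ is an object with commuting left and right $H$-actions $\mu_l,\mu_r$ and commuting left and right $H$-coactions $\nu_l,\nu_r$ such that both coactions are bimodule morphisms for the diagonal actions. A bicovariant first order differential calculus over $H$ is a Hopf bimodule $X$ with a bicomodule morphism $d:H\to X$ (where $H$ coacts on itself by $\Delta$) such that $d\circ m=\mu_r\circ(d\otimes \mathrm{id})+\mu_l\circ(\mathrm{id}\otimes d)$ and $\operatorname{Im}(\mu_l\circ(\mathrm{id}\otimes d))=X$. Two calculi $(X,d)$, $(X',d')$ are identified if there is an isomorphism of Hopf bimodules $f:X\to X'$ with $f\circ d=d'$. A (right) crossed module over $H$ is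 an object $X$ with a right $H$-action $\mu_r$ and a right $H$-coaction $\nu_r$ satisfying $$(\mathrm{id}_X\otimes m)(\Psi_{H,X}\otimes \mathrm{id}_H)(\mathrm{id}_H\otimes\nu_r\mu_r)(\Psi_{X,H}\otimes \mathrm{id}_H)(\mathrm{id}_X\otimes\Delta)=(\mu_r\otimes m)(\mathrm{id}_X\otimes\Psi_{H,H}\otimes \mathrm{id}_H)(\nu_r\otimes\Delta).$$ Regard $H\otimes H$ as a Hopf bimodule with left action $m\otimes\mathrm{id}$, right action $\mathrm{id}\otimes m$ and codiagonal left and right coactions, and $H$ as a Hopf bimodule through $m$ and $\Delta$. Then $m:H\otimes H\to H$ is a morphism of Hopf bimodules, and $H_{(2)}:=\operatorname{Ker}(m)$ is a Hopf bimodule. Let $D:H\to H_{(2)}$ be the morphism with $\ker(m)\circ D=\eta\otimes\mathrm{id}-\mathrm{id}\otimes\eta$. Let $H^{\mathrm{ad}}$ be the crossed module $H$ with right action $m$ and right coadjoint coaction $(\mathrm{id}\otimes m(S\otimes\mathrm{id}))(\Psi_{H,H}\otimes\mathrm{id})(\mathrm{id}\otimes\Delta)\Delta$, and let $\mathbf 1$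 carry the trivial crossed module structure given by $\varepsilon$ and $\eta$. Then $\varepsilon:H^{\mathrm{ad}}\to\mathbf 1$ is a morphism of crossed modules, and $\operatorname{Ker}\varepsilon$ is a crossed module. Hopf sub-bimodules and crossed submodules are subobjects in $\mathcal C$ that are represented by a morphism of Hopf bimodules, respectively of crossed modules. **Corollary.** The isomorphism classes of bicovariant first order differential calculi over $H$ are in one-to-one correspondence both with 1. the Hopf sub-bimodules of $H_{(2)}=\operatorname{Ker}(m)$, and with 2. the crossed submodules of $\operatorname{Ker}\varepsilon$, where $\varepsilon:H^{\mathrm{ad}}\to\mathbf 1$. More precisely, there are bijections $\Phi_1$ and $\Phi_2$ from the isomorphism classes of calculi onto the sets in (1) and (2) such that: $\Phi_1$ sends the class of $(X,d)$ to $\operatorname{Ker}(\pi)$, for a morphism of Hopf bimodules $\pi:H_{(2)}\to X$ with $\pi\circ D=d$; and if $N\subseteq H\otimes H$ and $M\subseteq H$ are the subobjects that $\Phi_1$ and $\Phi_2$ assign to the same calculus, then $\theta(N)=H\otimes M$ as subobjects of $H\otimes H$, where $\theta=(m\otimes\mathrm{id})(\mathrm{id}\otimes\Delta):H\otimes H\to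 H\otimes H$. -/

import Mathlib

open CategoryTheory MonoidalCategory Limits
open scoped MonObj ComonObj HopfObj

universe v u

/-!
Bicovariant first order differential calculi over a Hopf algebra in a braided abelian category.
Morphisms are composed in diagrammatic order; `μ`, `η`, `Δ`, `ε`, `𝒮` are the structure
morphisms of a Hopf algebra in `C`, and `β_` is the braiding.
-/

namespace BraidedCalculus

set_option linter.unusedSectionVars false
set_option linter.unusedSimpArgs false
set_option linter.style.longLine false

variable {C : Type u} [Category.{v} C] [MonoidalCategory C]

/-- The convolution product of morphisms from a coalgebra to an algebra. -/
def conv {M N : C} [ComonObj M] [MonObj N] (f g : M ⟶ N) : M ⟶ N := Δ[M] ≫ (f ⊗ₘ g) ≫ μ[N]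

theorem conv_eq {M N : C} [ComonObj M] [MonObj N] (f g : M ⟶ N) :
    conv f g = ((show Conv M N from f) * (show Conv M N from g) : Conv M N) := by
  rw [conv, Conv.mul_eq, MonoidalCategory.tensorHom_def, Category.assoc]

theorem conv_assoc {M N : C} [ComonObj M] [MonObj N] (f g h : M ⟶ N) :
    conv (conv f g) h = conv f (conv g h) := by
  rw [conv_eq, conv_eq f, conv_eq f, conv_eq g]
  exact mul_assoc (G := Conv M N) _ _ _

theorem one_conv {M N : C} [ComonObj M] [MonObj N] (f : M ⟶ N) :
    conv (ε ≫ η) f = f := by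
  simp only [conv_eq]
  exact one_mul (M := Conv M N) _

theorem conv_comp {M N P : C} [ComonObj M] [MonObj N] [MonObj P] (f g : M ⟶ N) (k : N ⟶ P)
    [IsMonHom k] : conv f g ≫ k = conv (f ≫ k) (g ≫ k) := by
  simp [conv]

theorem comp_conv {L M N : C} [ComonObj L] [ComonObj M] [MonObj N] (k : L ⟶ M) [IsComonHom k]
    (f g : M ⟶ N) : k ≫ conv f g = conv (k ≫ f) (k ≫ g) := by
  simp [conv]

theorem conv_cancel {M N : C} [ComonObj M] [MonObj N] {a b f g : M ⟶ N}
    (hab : conv b a = ε ≫ η) (h : conv a f = conv a g) : f = g := by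
  rw [← one_conv f, ← hab, conv_assoc, h, ← conv_assoc, hab, one_conv]

theorem isMonHom_one (A : C) [MonObj A] : IsMonHom η[A] where
  mul_hom := by simp [unitors_equal]

attribute [local instance] isMonHom_one

variable [BraidedCategory C]

/-- The inclusion `η ⊗ id` of the right tensor factor. -/
def incR (A B : C) [MonObj A] : B ⟶ A ⊗ B := (λ_ B).inv ≫ η[A] ▷ B
/-- The inclusion `id ⊗ η` of the left tensor factor. -/
def incL (A B : C) [MonObj B] : A ⟶ A ⊗ B := (ρ_ A).inv ≫ A ◁ η[B]

theorem isMonHom_incR (A B : C) [MonObj A] [MonObj B] : IsMonHom (incR A B) := by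
  unfold incR; infer_instance

theorem isMonHom_incL (A B : C) [MonObj A] [MonObj B] : IsMonHom (incL A B) := by
  unfold incL; infer_instance

attribute [local instance] isMonHom_incR isMonHom_incL

theorem incR_mul (A B : C) [MonObj A] [MonObj B] :
    incR A B ▷ (A ⊗ B) ≫ μ =
      (α_ B A B).inv ≫ (β_ B A).hom ▷ B ≫ (α_ A B B).hom ≫ A ◁ μ := by
  rw [MonObj.tensorObj.mul_def, incR]
  have h2 := tensorμ_natural_left η[A] (𝟙 B) A B
  rw [MonoidalCategory.tensorHom_id] at h2
  rw [comp_whiskerRight, Category.assoc, reassoc_of% h2]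
  simp only [tensorHom_comp_tensorHom, MonObj.one_mul, id_whiskerRight, Category.id_comp]
  simp only [tensorμ, MonoidalCategory.tensorHom_def]
  monoidal

theorem incL_mul (A B : C) [MonObj A] [MonObj B] :
    incL A B ▷ (A ⊗ B) ≫ μ = (α_ A A B).inv ≫ μ ▷ B := by
  rw [MonObj.tensorObj.mul_def, incL]
  have h2 := tensorμ_natural_left (𝟙 A) η[B] A B
  rw [MonoidalCategory.id_tensorHom] at h2
  rw [comp_whiskerRight, Category.assoc, reassoc_of% h2]
  simp only [tensorHom_comp_tensorHom, MonObj.one_mul, id_whiskerRight, Category.id_comp]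
  simp only [tensorμ, MonoidalCategory.tensorHom_def, braiding_tensorUnit_left]
  monoidal

theorem incL_incR_mul (A B : C) [MonObj A] [MonObj B] :
    (incL A B ⊗ₘ incR A B) ≫ μ = 𝟙 (A ⊗ B) := by
  rw [MonoidalCategory.tensorHom_def', Category.assoc, incL_mul, incR]
  have : A ◁ η[A] ▷ B ≫ (α_ A A B).inv ≫ μ ▷ B = (α_ A (𝟙_ C) B).inv ≫ (ρ_ A).hom ▷ B := by
    rw [← MonObj.mul_one A]; monoidal
  simp [this]

theorem conv_incR_whisker {A A' B M : C} [MonObj A] [MonObj A'] [MonObj B] [ComonObj M]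
    (k : M ⟶ B) (f : M ⟶ A ⊗ B) (g : A ⟶ A') :
    conv (k ≫ incR A B) f ≫ g ▷ B = conv (k ≫ incR A' B) (f ≫ g ▷ B) := by
  simp only [conv, MonoidalCategory.tensorHom_def', comp_whiskerRight, Category.assoc, incR_mul,
    MonoidalCategory.whiskerLeft_comp]
  rw [whisker_exchange_assoc, whisker_exchange_assoc, whisker_exchange]
  rw [associator_inv_naturality_middle_assoc, ← comp_whiskerRight_assoc (B ◁ g),
    BraidedCategory.braiding_naturality_right]
  simp
  rw [← associator_inv_naturality_left_assoc, whisker_exchange_assoc]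

section Coadjoint
variable (H : C) [HopfObj H]

/-- The right coadjoint coaction of `H` on itself (`h ↦ h₂ ⊗ S(h₁) h₃` for a symmetric braiding),
the categorical dual of the right adjoint action. -/
def coadj : H ⟶ H ⊗ H :=
  Δ ≫ H ◁ Δ ≫ (α_ H H H).inv ≫ (β_ H H).hom ▷ H ≫ (α_ H H H).hom ≫ H ◁ (𝒮 ▷ H ≫ μ)

theorem coadj_eq : coadj H = conv (𝒮 ≫ incR H H) Δ := by
  simp only [conv, coadj, MonoidalCategory.tensorHom_def', comp_whiskerRight, Category.assoc,
    incR_mul, MonoidalCategory.whiskerLeft_comp]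
  congr 2
  rw [associator_inv_naturality_left_assoc, ← comp_whiskerRight_assoc (𝒮 ▷ H),
    BraidedCategory.braiding_naturality_left]
  simp

theorem inv_inc : conv (𝒮 ≫ incR H H) (incR H H) = ε ≫ η := by
  have := conv_comp 𝒮[H] (𝟙 H) (incR H H)
  rw [Category.id_comp] at this
  rw [← this, conv, tensorHom_id]
  simp

theorem inc_inv : conv (incR H H) (𝒮 ≫ incR H H) = ε ≫ η := by
  have := conv_comp (𝟙 H) 𝒮[H] (incR H H)
  rw [Category.id_comp] at this
  rw [← this, conv, id_tensorHom]
  simp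

theorem inc_coadj : conv (incR H H) (coadj H) = Δ := by
  rw [coadj_eq, ← conv_assoc, inc_inv, one_conv]

theorem isMonHom_counit (H : C) [BimonObj H] : IsMonHom ε[H] where
  mul_hom := by simp

theorem isMonHom_comul (H : C) [BimonObj H] : IsMonHom Δ[H] where
  mul_hom := by simp [MonObj.tensorObj.mul_def]

attribute [local instance] isMonHom_counit isMonHom_comul

theorem coadj_counit : coadj H ≫ H ◁ ε = (ρ_ H).inv := by
  rw [coadj_eq, conv_comp]
  have : 𝒮 ≫ incR H H ≫ H ◁ ε = ε ≫ η := by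
    rw [incR, Category.assoc, ← whisker_exchange, leftUnitor_inv_naturality_assoc]
    have h := HopfObj.antipode_counit H
    rw [← MonoidalCategory.whiskerLeft_comp_assoc, h, MonObj.tensorObj.one_def]
    simp [MonoidalCategory.tensorHom_def, unitors_inv_equal]
  rw [Category.assoc, this, one_conv]
  simp

theorem coadj_counit_left : coadj H ≫ ε ▷ H = ε ≫ η ≫ (λ_ H).inv := by
  rw [coadj_eq, conv_comp]
  have : incR H H ≫ ε ▷ H = (λ_ H).inv := by
    rw [incR, Category.assoc, ← comp_whiskerRight, BimonObj.one_counit]; simp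
  rw [Category.assoc, this, ComonObj.counit_comul]
  have h2 := conv_comp 𝒮[H] (𝟙 H) (λ_ H).inv
  rw [Category.id_comp] at h2
  rw [← h2, conv, tensorHom_id]
  simp

theorem coadj_coassoc : coadj H ≫ coadj H ▷ H = coadj H ≫ H ◁ Δ ≫ (α_ H H H).inv := by
  have e : incR H H ≫ H ◁ Δ ≫ (α_ H H H).inv = Δ ≫ incR H H ▷ H := by
    simp only [incR, Category.assoc, ← whisker_exchange_assoc, comp_whiskerRight]
    monoidal
  refine conv_cancel (a := incR H H ≫ H ◁ Δ ≫ (α_ H H H).inv)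
    (b := 𝒮 ≫ incR H H ≫ H ◁ Δ ≫ (α_ H H H).inv) ?_ ?_
  · have := conv_comp (𝒮 ≫ incR H H) (incR H H) (H ◁ Δ ≫ (α_ H H H).inv)
    simp only [Category.assoc] at this
    rw [← this, inv_inc]
    simp
  · rw [← conv_comp, inc_coadj, e]
    have e2 : Δ ≫ incR H H ▷ H = conv (incR H H ≫ incL (H ⊗ H) H) (incR (H ⊗ H) H) := by
      have : (incR H H ≫ incL (H ⊗ H) H ⊗ₘ incR (H ⊗ H) H) =
          incR H H ▷ H ≫ (incL (H ⊗ H) H ⊗ₘ incR (H ⊗ H) H) := by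
        rw [← tensorHom_id, tensorHom_comp_tensorHom, Category.id_comp]
      rw [conv, this, Category.assoc, incL_incR_mul, Category.comp_id]
    have e3 := conv_incR_whisker (𝟙 H) (coadj H) (coadj H)
    simp only [Category.id_comp] at e3
    rw [e2, conv_assoc, ← e3, inc_coadj, conv, MonoidalCategory.tensorHom_def', Category.assoc,
      comp_whiskerRight, Category.assoc, incL_mul]
    have e4 := congrArg (fun f => f ▷ H) (inc_coadj H)
    simp only [conv, comp_whiskerRight, MonoidalCategory.tensorHom_def'] at e4
    rw [← ComonObj.comul_assoc_flip, ← e4]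
    simp only [MonoidalCategory.whiskerLeft_comp, Category.assoc]
    rw [ComonObj.comul_assoc_flip_assoc]
    simp

theorem isComonHom_mul (H : C) [BimonObj H] : IsComonHom μ[H] where
  hom_comul := by simp [MonObj.tensorObj.mul_def]

/-- The projection `id ⊗ ε`. -/
def prL (A B : C) [ComonObj B] : A ⊗ B ⟶ A := A ◁ ε[B] ≫ (ρ_ A).hom
/-- The projection `ε ⊗ id`. -/
def prR (A B : C) [ComonObj A] : A ⊗ B ⟶ B := ε[A] ▷ B ≫ (λ_ B).hom

theorem comul_prR (A B : C) [ComonObj A] [ComonObj B] :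
    Δ[A ⊗ B] ≫ prR A B ▷ (A ⊗ B) =
      A ◁ Δ ≫ (α_ A B B).inv ≫ (β_ A B).hom ▷ B ≫ (α_ B A B).hom := by
  have h := tensorμ_natural ε[A] (𝟙 A) (𝟙 B) (𝟙 B)
  simp only [tensorHom_id, id_whiskerRight] at h
  rw [prR, comp_whiskerRight, Comon.tensorObj_comul, Category.assoc, ← reassoc_of% h,
    MonoidalCategory.tensorHom_def'_assoc, ← comp_whiskerRight_assoc,
    ComonObj.counit_comul]
  simp only [tensorμ]
  monoidal

theorem comul_prL (A B : C) [ComonObj A] [ComonObj B] :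
    Δ[A ⊗ B] ≫ prL A B ▷ (A ⊗ B) = Δ ▷ B ≫ (α_ A A B).hom := by
  have h := tensorμ_natural (𝟙 A) (𝟙 A) ε[B] (𝟙 B)
  simp only [tensorHom_id, id_whiskerRight, id_tensorHom] at h
  rw [prL, comp_whiskerRight, Comon.tensorObj_comul, Category.assoc, ← reassoc_of% h,
    MonoidalCategory.tensorHom_def_assoc, ← MonoidalCategory.whiskerLeft_comp_assoc,
    ComonObj.counit_comul]
  simp only [tensorμ, braiding_tensorUnit_right]
  monoidal

theorem comul_prL_prR (A B : C) [ComonObj A] [ComonObj B] :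
    Δ[A ⊗ B] ≫ (prL A B ⊗ₘ prR A B) = 𝟙 _ := by
  rw [MonoidalCategory.tensorHom_def, ← Category.assoc, comul_prL, prR]
  have : Δ ▷ B ≫ (α_ A A B).hom ≫ A ◁ ε[A] ▷ B = (ρ_ A).inv ▷ B ≫ (α_ A (𝟙_ C) B).hom := by
    rw [← ComonObj.comul_counit]; monoidal
  simp [reassoc_of% this]

theorem isComonHom_prL (A B : C) [ComonObj A] [ComonObj B] : IsComonHom (prL A B) where
  hom_counit := by simp [prL, MonoidalCategory.tensorHom_def', unitors_equal]
  hom_comul := by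
    rw [MonoidalCategory.tensorHom_def, ← Category.assoc, comul_prL, prL]
    simp only [Category.assoc, MonoidalCategory.whiskerLeft_comp]
    rw [← rightUnitor_naturality, whisker_exchange_assoc]
    monoidal

attribute [local instance] isComonHom_mul isComonHom_prL

theorem coadj_crossed :
    H ◁ Δ ≫ (α_ H H H).inv ≫ (β_ H H).hom ▷ H ≫ (α_ H H H).hom ≫ H ◁ (μ ≫ coadj H) ≫
      (α_ H H H).inv ≫ (β_ H H).hom ▷ H ≫ (α_ H H H).hom ≫ H ◁ μ =
    (coadj H ⊗ₘ Δ) ≫ tensorμ H H H H ≫ (μ ⊗ₘ μ) := by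
  have hL : H ◁ Δ ≫ (α_ H H H).inv ≫ (β_ H H).hom ▷ H ≫ (α_ H H H).hom ≫ H ◁ (μ ≫ coadj H) ≫
      (α_ H H H).inv ≫ (β_ H H).hom ▷ H ≫ (α_ H H H).hom ≫ H ◁ μ =
      conv (prR H H ≫ incR H H) (μ ≫ coadj H) := by
    have h := comul_prR H H
    simp only [← Category.assoc] at h
    rw [← incR_mul]
    simp only [← Category.assoc]
    rw [← h]
    simp only [Category.assoc]
    rw [ conv, MonoidalCategory.tensorHom_def, comp_whiskerRight,
      Category.assoc, whisker_exchange_assoc]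
    simp only [Category.assoc]
  have hR : (coadj H ⊗ₘ Δ) ≫ tensorμ H H H H ≫ (μ ⊗ₘ μ) = conv (prL H H ≫ coadj H) (prR H H ≫ Δ) := by
    rw [conv, ← tensorHom_comp_tensorHom, Category.assoc, reassoc_of% (comul_prL_prR H H)]
    rfl
  have hp : conv (prL H H) (prR H H) = μ := by
    rw [conv, reassoc_of% (comul_prL_prR H H)]
  rw [hL, hR]
  refine conv_cancel (a := prL H H ≫ incR H H) (b := prL H H ≫ 𝒮 ≫ incR H H) ?_ ?_
  · rw [← comp_conv, inv_inc, IsComonHom.hom_counit_assoc]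
  · rw [← conv_assoc, ← conv_assoc, ← comp_conv, inc_coadj, ← conv_comp, ← conv_comp, hp,
      ← comp_conv, inc_coadj]


end Coadjoint

/-- Hopf bimodules over the bialgebra `H` in `C`: objects that are simultaneously `H`-bimodules
and `H`-bicomodules, such that both coactions are bimodule morphisms, where `H ⊗ X` and `X ⊗ H`
carry the diagonal actions built with the braiding. -/
structure HopfBimod (H : C) [BimonObj H] where
  X : C
  lact : H ⊗ X ⟶ X
  ract : X ⊗ H ⟶ X
  lcoact : X ⟶ H ⊗ X
  rcoact : X ⟶ X ⊗ H
  one_lact : η ▷ X ≫ lact = (λ_ X).hom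
  mul_lact : μ ▷ X ≫ lact = (α_ H H X).hom ≫ H ◁ lact ≫ lact
  ract_one : X ◁ η ≫ ract = (ρ_ X).hom
  ract_mul : X ◁ μ ≫ ract = (α_ X H H).inv ≫ ract ▷ H ≫ ract
  lact_ract : lact ▷ H ≫ ract = (α_ H X H).hom ≫ H ◁ ract ≫ lact
  lcoact_counit : lcoact ≫ ε ▷ X = (λ_ X).inv
  lcoact_comul : lcoact ≫ Δ ▷ X = lcoact ≫ H ◁ lcoact ≫ (α_ H H X).inv
  rcoact_counit : rcoact ≫ X ◁ ε = (ρ_ X).inv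
  rcoact_comul : rcoact ≫ X ◁ Δ = rcoact ≫ rcoact ▷ H ≫ (α_ X H H).hom
  lcoact_rcoact : rcoact ≫ lcoact ▷ H = lcoact ≫ H ◁ rcoact ≫ (α_ H X H).inv
  lact_lcoact : lact ≫ lcoact = (Δ ⊗ₘ lcoact) ≫ tensorμ H H H X ≫ (μ ⊗ₘ lact)
  ract_lcoact : ract ≫ lcoact = (lcoact ⊗ₘ Δ) ≫ tensorμ H X H H ≫ (μ ⊗ₘ ract)
  lact_rcoact : lact ≫ rcoact = (Δ ⊗ₘ rcoact) ≫ tensorμ H H X H ≫ (lact ⊗ₘ μ)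
  ract_rcoact : ract ≫ rcoact = (rcoact ⊗ₘ Δ) ≫ tensorμ X H H H ≫ (ract ⊗ₘ μ)

namespace HopfBimod
variable {H : C} [BimonObj H]

/-- Morphisms of Hopf bimodules: bimodule and bicomodule morphisms. -/
@[ext]
structure Hom (X Y : HopfBimod H) where
  hom : X.X ⟶ Y.X
  lact_hom : X.lact ≫ hom = H ◁ hom ≫ Y.lact
  ract_hom : X.ract ≫ hom = hom ▷ H ≫ Y.ract
  hom_lcoact : hom ≫ Y.lcoact = X.lcoact ≫ H ◁ hom
  hom_rcoact : hom ≫ Y.rcoact = X.rcoact ≫ hom ▷ H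

instance : Category (HopfBimod H) where
  Hom := Hom
  id X := ⟨𝟙 X.X, by simp, by simp, by simp, by simp⟩
  comp f g := ⟨f.hom ≫ g.hom, by simp [reassoc_of% f.lact_hom, g.lact_hom],
    by simp [reassoc_of% f.ract_hom, g.ract_hom],
    by simp [← reassoc_of% f.hom_lcoact, g.hom_lcoact],
    by simp [← reassoc_of% f.hom_rcoact, g.hom_rcoact]⟩

variable (H) in
/-- `H` with multiplication as actions and comultiplication as coactions. -/
def regular : HopfBimod H where
  X := H
  lact := μ
  ract := μ
  lcoact := Δ
  rcoact := Δ
  one_lact := by simp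
  mul_lact := by simp
  ract_one := by simp
  ract_mul := by simp
  lact_ract := by simp
  lcoact_counit := by simp
  lcoact_comul := by simp
  rcoact_counit := by simp
  rcoact_comul := by simp
  lcoact_rcoact := by simp
  lact_lcoact := BimonObj.mul_comul H
  ract_lcoact := BimonObj.mul_comul H
  lact_rcoact := BimonObj.mul_comul H
  ract_rcoact := BimonObj.mul_comul H

theorem isComonHom_assoc (A B D : C) [ComonObj A] [ComonObj B] [ComonObj D] :
    IsComonHom (α_ A B D).hom := by
  have h := (α_ (Comon.mk A) (Comon.mk B) (Comon.mk D)).hom.isComonHom_hom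
  have e : (α_ (Comon.mk A) (Comon.mk B) (Comon.mk D)).hom.hom = (α_ A B D).hom := by
    rw [Comon.monoidal_associator_hom_hom]
    exact (show 𝟙 (A ⊗ B) ▷ D ≫ (α_ A B D).hom ≫ A ◁ 𝟙 (B ⊗ D) = (α_ A B D).hom by simp)
  rwa [e] at h

theorem isComonHom_assoc_inv (A B D : C) [ComonObj A] [ComonObj B] [ComonObj D] :
    IsComonHom (α_ A B D).inv :=
  have := isComonHom_assoc A B D
  inferInstance

theorem isComonHom_whiskerRight {A B : C} (f : A ⟶ B) (D : C) [ComonObj A] [ComonObj B]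
    [ComonObj D] [IsComonHom f] : IsComonHom (f ▷ D) := by
  have := ((Comon.Hom.mk f : Comon.mk A ⟶ Comon.mk B) ▷ Comon.mk D).isComonHom_hom
  rwa [Comon.monoidal_whiskerRight_hom] at this

theorem isComonHom_whiskerLeft {A B : C} (f : A ⟶ B) (D : C) [ComonObj A] [ComonObj B]
    [ComonObj D] [IsComonHom f] : IsComonHom (D ◁ f) := by
  have := (Comon.mk D ◁ (Comon.Hom.mk f : Comon.mk A ⟶ Comon.mk B)).isComonHom_hom
  rwa [Comon.monoidal_whiskerLeft_hom] at this

attribute [local instance] isComonHom_mul isComonHom_assoc isComonHom_assoc_inv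
  isComonHom_whiskerLeft isComonHom_whiskerRight

section
variable {A D : C} [BimonObj A] [ComonObj D] (p : D ⟶ A)

theorem lcoact_comul_aux [IsComonHom p] : (Δ ≫ p ▷ D) ≫ Δ ▷ D = (Δ ≫ p ▷ D) ≫ A ◁ (Δ ≫ p ▷ D) ≫ (α_ A A D).inv := by
  rw [Category.assoc, ← comp_whiskerRight, IsComonHom.hom_comul, comp_whiskerRight, ComonObj.comul_assoc_flip_assoc]
  simp only [MonoidalCategory.tensorHom_def]
  simp only [MonoidalCategory.whiskerLeft_comp, Category.assoc]
  rw [← whisker_exchange_assoc]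
  monoidal

theorem rcoact_comul_aux [IsComonHom p] : (Δ ≫ D ◁ p) ≫ D ◁ Δ = (Δ ≫ D ◁ p) ≫ (Δ ≫ D ◁ p) ▷ A ≫ (α_ D A A).hom := by
  rw [Category.assoc, ← MonoidalCategory.whiskerLeft_comp, IsComonHom.hom_comul, MonoidalCategory.whiskerLeft_comp,
    ComonObj.comul_assoc_assoc]
  simp only [MonoidalCategory.tensorHom_def']
  simp only [comp_whiskerRight, Category.assoc]
  rw [whisker_exchange_assoc]
  monoidal

theorem lcoact_rcoact_aux : (Δ ≫ D ◁ p) ≫ (Δ ≫ p ▷ D) ▷ A = (Δ ≫ p ▷ D) ≫ A ◁ (Δ ≫ D ◁ p) ≫ (α_ A D A).inv := by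
  simp only [comp_whiskerRight, Category.assoc, MonoidalCategory.whiskerLeft_comp]
  rw [← whisker_exchange_assoc, ← whisker_exchange_assoc p (D ◁ p),
    whisker_exchange_assoc Δ[D] p, ComonObj.comul_assoc_flip_assoc]
  monoidal

theorem lact_lcoact_aux (f : A ⊗ D ⟶ D) [IsComonHom f] (h : f ≫ p = A ◁ p ≫ μ) :
    f ≫ Δ ≫ p ▷ D = (Δ ⊗ₘ (Δ ≫ p ▷ D)) ≫ tensorμ A A A D ≫ (μ ⊗ₘ f) := by
  have h' : (Δ[A] ⊗ₘ (Δ ≫ p ▷ D)) = (Δ ⊗ₘ Δ) ≫ (𝟙 (A ⊗ A) ⊗ₘ (p ⊗ₘ 𝟙 D)) := by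
    rw [tensorHom_comp_tensorHom, Category.comp_id]; simp
  rw [h', Category.assoc, ← id_tensorHom_id, reassoc_of% tensorμ_natural (𝟙 A) (𝟙 A) p (𝟙 D),
    IsComonHom.hom_comul_assoc, Comon.tensorObj_comul, Category.assoc,
    tensorHom_comp_tensorHom]
  simp only [id_tensorHom, tensorHom_id, id_whiskerRight, Category.id_comp, ← h]
  rw [← tensorHom_id, tensorHom_comp_tensorHom, Category.comp_id]

theorem lact_rcoact_aux (f : A ⊗ D ⟶ D) [IsComonHom f] (h : f ≫ p = A ◁ p ≫ μ) :
    f ≫ Δ ≫ D ◁ p = (Δ ⊗ₘ (Δ ≫ D ◁ p)) ≫ tensorμ A A D A ≫ (f ⊗ₘ μ) := by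
  have h' : (Δ[A] ⊗ₘ (Δ ≫ D ◁ p)) = (Δ ⊗ₘ Δ) ≫ (𝟙 (A ⊗ A) ⊗ₘ (𝟙 D ⊗ₘ p)) := by
    rw [tensorHom_comp_tensorHom, Category.comp_id]; simp
  rw [h', Category.assoc, ← id_tensorHom_id, reassoc_of% tensorμ_natural (𝟙 A) (𝟙 A) (𝟙 D) p,
    IsComonHom.hom_comul_assoc, Comon.tensorObj_comul, Category.assoc,
    tensorHom_comp_tensorHom]
  simp only [id_tensorHom, tensorHom_id, id_whiskerRight, Category.id_comp, ← h]
  rw [← id_tensorHom, tensorHom_comp_tensorHom, Category.comp_id]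

theorem ract_lcoact_aux (f : D ⊗ A ⟶ D) [IsComonHom f] (h : f ≫ p = p ▷ A ≫ μ) :
    f ≫ Δ ≫ p ▷ D = ((Δ ≫ p ▷ D) ⊗ₘ Δ) ≫ tensorμ A D A A ≫ (μ ⊗ₘ f) := by
  have h' : ((Δ ≫ p ▷ D) ⊗ₘ Δ[A]) = (Δ ⊗ₘ Δ) ≫ ((p ⊗ₘ 𝟙 D) ⊗ₘ 𝟙 (A ⊗ A)) := by
    rw [tensorHom_comp_tensorHom, Category.comp_id]; simp
  rw [h', Category.assoc, ← id_tensorHom_id, reassoc_of% tensorμ_natural p (𝟙 D) (𝟙 A) (𝟙 A),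
    IsComonHom.hom_comul_assoc, Comon.tensorObj_comul, Category.assoc,
    tensorHom_comp_tensorHom]
  simp only [id_tensorHom, tensorHom_id, id_whiskerRight, Category.id_comp, ← h]
  rw [← tensorHom_id, tensorHom_comp_tensorHom, Category.comp_id]

theorem ract_rcoact_aux (f : D ⊗ A ⟶ D) [IsComonHom f] (h : f ≫ p = p ▷ A ≫ μ) :
    f ≫ Δ ≫ D ◁ p = ((Δ ≫ D ◁ p) ⊗ₘ Δ) ≫ tensorμ D A A A ≫ (f ⊗ₘ μ) := by
  have h' : ((Δ ≫ D ◁ p) ⊗ₘ Δ[A]) = (Δ ⊗ₘ Δ) ≫ ((𝟙 D ⊗ₘ p) ⊗ₘ 𝟙 (A ⊗ A)) := by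
    rw [tensorHom_comp_tensorHom, Category.comp_id]; simp
  rw [h', Category.assoc, ← id_tensorHom_id, reassoc_of% tensorμ_natural (𝟙 D) p (𝟙 A) (𝟙 A),
    IsComonHom.hom_comul_assoc, Comon.tensorObj_comul, Category.assoc,
    tensorHom_comp_tensorHom]
  simp only [id_tensorHom, tensorHom_id, id_whiskerRight, Category.id_comp, ← h]
  rw [← id_tensorHom, tensorHom_comp_tensorHom, Category.comp_id]
end

variable (H) in
/-- `H ⊗ H` with the left action on the left factor, the right action on the right factor, and
the codiagonal left and right coactions. -/
def square : HopfBimod H where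
  X := H ⊗ H
  lact := (α_ H H H).inv ≫ μ ▷ H
  ract := (α_ H H H).hom ≫ H ◁ μ
  lcoact := (Δ ⊗ₘ Δ) ≫ tensorμ H H H H ≫ μ ▷ (H ⊗ H)
  rcoact := (Δ ⊗ₘ Δ) ≫ tensorμ H H H H ≫ (H ⊗ H) ◁ μ
  one_lact := by
    rw [associator_inv_naturality_left_assoc, ← comp_whiskerRight, MonObj.one_mul]
    monoidal
  mul_lact := by
    rw [associator_inv_naturality_left_assoc, ← comp_whiskerRight, MonObj.mul_assoc]
    monoidal
  ract_one := by
    rw [associator_naturality_right_assoc, ← MonoidalCategory.whiskerLeft_comp, MonObj.mul_one]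
    monoidal
  ract_mul := by
    rw [associator_naturality_right_assoc, ← MonoidalCategory.whiskerLeft_comp,
      MonObj.mul_assoc_flip]
    monoidal
  lact_ract := by
    simp only [comp_whiskerRight, Category.assoc, associator_naturality_left_assoc,
      MonoidalCategory.whiskerLeft_comp, associator_inv_naturality_right_assoc, whisker_exchange]
    monoidal
  lcoact_counit := by
    have h := ComonObj.counit_comul (H ⊗ H)
    rw [Comon.tensorObj_comul, Category.assoc] at h
    rw [← h, Category.assoc, Category.assoc, ← comp_whiskerRight, IsComonHom.hom_counit]
  lcoact_comul := by
    simpa only [Comon.tensorObj_comul, Category.assoc] using lcoact_comul_aux μ[H]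
  rcoact_counit := by
    have h := ComonObj.comul_counit (H ⊗ H)
    rw [Comon.tensorObj_comul, Category.assoc] at h
    rw [← h, Category.assoc, Category.assoc, ← MonoidalCategory.whiskerLeft_comp,
      IsComonHom.hom_counit]
  rcoact_comul := by
    simpa only [Comon.tensorObj_comul, Category.assoc] using rcoact_comul_aux μ[H]
  lcoact_rcoact := by
    simpa only [Comon.tensorObj_comul, Category.assoc] using lcoact_rcoact_aux μ[H]
  lact_lcoact := by
    simpa only [Comon.tensorObj_comul, Category.assoc] using
      lact_lcoact_aux μ[H] ((α_ H H H).inv ≫ μ ▷ H) (by simp)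
  ract_lcoact := by
    simpa only [Comon.tensorObj_comul, Category.assoc] using
      ract_lcoact_aux μ[H] ((α_ H H H).hom ≫ H ◁ μ) (by simp)
  lact_rcoact := by
    simpa only [Comon.tensorObj_comul, Category.assoc] using
      lact_rcoact_aux μ[H] ((α_ H H H).inv ≫ μ ▷ H) (by simp)
  ract_rcoact := by
    simpa only [Comon.tensorObj_comul, Category.assoc] using
      ract_rcoact_aux μ[H] ((α_ H H H).hom ≫ H ◁ μ) (by simp)

end HopfBimod

namespace HopfBimod
section
variable {H : C} [BimonObj H]

@[simp] theorem id_hom (X : HopfBimod H) : Hom.hom (𝟙 X) = 𝟙 X.X := rfl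

@[simp] theorem comp_hom {X Y Z : HopfBimod H} (f : X ⟶ Y) (g : Y ⟶ Z) :
    Hom.hom (f ≫ g) = Hom.hom f ≫ Hom.hom g := rfl

@[ext] theorem hom_ext {X Y : HopfBimod H} {f g : X ⟶ Y} (h : Hom.hom f = Hom.hom g) : f = g :=
  Hom.ext h

/-- A subobject of a Hopf bimodule that is stable under all structure morphisms is a
Hopf bimodule, provided tensoring with `H` respects the inclusion. -/
def ofMono (X : HopfBimod H) {K : C} (i : K ⟶ X.X) [Mono i]
    (hl : ∀ {A B : C} (f : A ⟶ B) [Mono f], Mono (H ◁ f))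
    (hr : ∀ {A B : C} (f : A ⟶ B) [Mono f], Mono (f ▷ H))
    (l : H ⊗ K ⟶ K) (r : K ⊗ H ⟶ K) (lc : K ⟶ H ⊗ K) (rc : K ⟶ K ⊗ H)
    (h₁ : l ≫ i = H ◁ i ≫ X.lact) (h₂ : r ≫ i = i ▷ H ≫ X.ract)
    (h₃ : lc ≫ H ◁ i = i ≫ X.lcoact) (h₄ : rc ≫ i ▷ H = i ≫ X.rcoact) : HopfBimod H where
  X := K
  lact := l
  ract := r
  lcoact := lc
  rcoact := rc
  one_lact := by
    rw [← cancel_mono i, Category.assoc, h₁, ← whisker_exchange_assoc, X.one_lact,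
      leftUnitor_naturality]
  mul_lact := by
    rw [← cancel_mono i]
    simp only [Category.assoc, h₁]
    rw [← whisker_exchange_assoc, X.mul_lact, ← MonoidalCategory.whiskerLeft_comp_assoc, h₁]
    simp
  ract_one := by
    rw [← cancel_mono i, Category.assoc, h₂, whisker_exchange_assoc, X.ract_one,
      rightUnitor_naturality]
  ract_mul := by
    rw [← cancel_mono i]
    simp only [Category.assoc, h₂]
    rw [whisker_exchange_assoc, X.ract_mul, ← comp_whiskerRight_assoc, h₂]
    simp
  lact_ract := by
    rw [← cancel_mono i]
    simp only [Category.assoc, h₁, h₂]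
    rw [← comp_whiskerRight_assoc, h₁, ← MonoidalCategory.whiskerLeft_comp_assoc, h₂]
    simp [X.lact_ract]
  lcoact_counit := by
    have : Mono ((𝟙_ C) ◁ i) := by
      rw [MonoidalCategory.id_whiskerLeft]
      infer_instance
    rw [← cancel_mono ((𝟙_ C) ◁ i)]
    rw [Category.assoc, ← whisker_exchange, reassoc_of% h₃, X.lcoact_counit]
    simp
  lcoact_comul := by
    have _ := hl i
    have : Mono ((H ⊗ H) ◁ i) := by
      rw [MonoidalCategory.tensor_whiskerLeft]
      have _ := hl (H ◁ i)
      infer_instance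
    rw [← cancel_mono ((H ⊗ H) ◁ i)]
    simp only [Category.assoc]
    rw [← whisker_exchange, reassoc_of% h₃, X.lcoact_comul, ← associator_inv_naturality_right,
      ← MonoidalCategory.whiskerLeft_comp_assoc, h₃, MonoidalCategory.whiskerLeft_comp,
      Category.assoc, reassoc_of% h₃]
  rcoact_counit := by
    have : Mono (i ▷ (𝟙_ C)) := by
      rw [MonoidalCategory.whiskerRight_id]
      infer_instance
    rw [← cancel_mono (i ▷ (𝟙_ C))]
    rw [Category.assoc, whisker_exchange, reassoc_of% h₄, X.rcoact_counit]
    simp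
  rcoact_comul := by
    have _ := hr i
    have : Mono (i ▷ (H ⊗ H)) := by
      rw [MonoidalCategory.whiskerRight_tensor]
      have _ := hr (i ▷ H)
      infer_instance
    rw [← cancel_mono (i ▷ (H ⊗ H))]
    simp only [Category.assoc]
    rw [whisker_exchange, reassoc_of% h₄, X.rcoact_comul, ← associator_naturality_left,
      ← comp_whiskerRight_assoc, h₄, comp_whiskerRight, Category.assoc, reassoc_of% h₄]
  lcoact_rcoact := by
    have _ := hl i
    have _ := hr (H ◁ i)
    rw [← cancel_mono ((H ◁ i) ▷ H)]
    simp only [Category.assoc]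
    rw [← comp_whiskerRight, h₃, comp_whiskerRight, reassoc_of% h₄, X.lcoact_rcoact,
      ← associator_inv_naturality_middle, ← MonoidalCategory.whiskerLeft_comp_assoc, h₄,
      MonoidalCategory.whiskerLeft_comp, Category.assoc, reassoc_of% h₃]
  lact_lcoact := by
    have _ := hl i
    rw [← cancel_mono (H ◁ i)]
    have e := tensorμ_natural_right H H (𝟙 H) i
    simp only [Category.assoc, h₃, reassoc_of% h₁, X.lact_lcoact]
    rw [← id_tensorHom H i, tensorHom_comp_tensorHom_assoc, Category.id_comp, ← h₃,
      tensorHom_comp_tensorHom, Category.comp_id, h₁,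
      ← id_tensorHom H i, ← Category.comp_id (Δ[H]), ← tensorHom_comp_tensorHom_assoc, ← id_tensorHom_id, tensorμ_natural_assoc, tensorHom_comp_tensorHom]
    simp
  ract_lcoact := by
    have _ := hl i
    rw [← cancel_mono (H ◁ i)]
    simp only [Category.assoc, h₃, reassoc_of% h₂, X.ract_lcoact]
    rw [← tensorHom_id i H, tensorHom_comp_tensorHom_assoc, Category.id_comp, ← h₃,
      ← id_tensorHom H i, tensorHom_comp_tensorHom, Category.comp_id, id_tensorHom, h₂,
      ← tensorHom_id i H, ← Category.comp_id (Δ[H]), ← id_tensorHom,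
      ← tensorHom_comp_tensorHom_assoc, ← id_tensorHom_id, tensorμ_natural_assoc,
      tensorHom_comp_tensorHom]
    simp
  lact_rcoact := by
    have _ := hr i
    rw [← cancel_mono (i ▷ H)]
    simp only [Category.assoc, h₄, reassoc_of% h₁, X.lact_rcoact]
    rw [← id_tensorHom H i, tensorHom_comp_tensorHom_assoc, Category.id_comp, ← h₄,
      ← tensorHom_id i H, tensorHom_comp_tensorHom, Category.comp_id, tensorHom_id, h₁,
      ← id_tensorHom H i, ← Category.comp_id (Δ[H]), ← tensorHom_id,
      ← tensorHom_comp_tensorHom_assoc, ← id_tensorHom_id, tensorμ_natural_assoc,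
      tensorHom_comp_tensorHom]
    simp
  ract_rcoact := by
    have _ := hr i
    have h₂' : r ≫ i = (i ⊗ₘ 𝟙 H) ≫ X.ract := by rw [h₂, tensorHom_id]
    rw [← cancel_mono (i ▷ H)]
    simp only [Category.assoc, h₄, reassoc_of% h₂, X.ract_rcoact]
    rw [← tensorHom_id i H, tensorHom_comp_tensorHom_assoc, Category.id_comp, ← h₄,
      ← tensorHom_id i H, tensorHom_comp_tensorHom, Category.comp_id, h₂', ← Category.comp_id (Δ[H]),
      ← tensorHom_comp_tensorHom_assoc, ← id_tensorHom_id, tensorμ_natural_assoc,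
      tensorHom_comp_tensorHom]
    simp

end
end HopfBimod

namespace HopfBimod

variable (H : C) [BimonObj H] in
/-- The multiplication `H ⊗ H ⟶ H` is a morphism of Hopf bimodules. -/
def mulHom : square H ⟶ regular H where
  hom := μ[H]
  lact_hom := by simp [square, regular]
  ract_hom := by simp [square, regular]
  hom_lcoact := by
    simp [square, regular, BimonObj.mul_comul, MonoidalCategory.tensorHom_def]
  hom_rcoact := by
    simp [square, regular, BimonObj.mul_comul, MonoidalCategory.tensorHom_def']

end HopfBimod

/-- Crossed modules (right Yetter-Drinfeld modules) over the bialgebra `H` in `C`: right modules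
and right comodules whose action and coaction satisfy the braided crossed module identity
(`x₀ h₁ ⊗ x₁ h₂ = (x h₂)₀ ⊗ h₁ (x h₂)₁` for a symmetric braiding). -/
structure CrossedModule (H : C) [BimonObj H] where
  X : C
  ract : X ⊗ H ⟶ X
  rcoact : X ⟶ X ⊗ H
  ract_one : X ◁ η ≫ ract = (ρ_ X).hom
  ract_mul : X ◁ μ ≫ ract = (α_ X H H).inv ≫ ract ▷ H ≫ ract
  rcoact_counit : rcoact ≫ X ◁ ε = (ρ_ X).inv
  rcoact_comul : rcoact ≫ X ◁ Δ = rcoact ≫ rcoact ▷ H ≫ (α_ X H H).hom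
  crossed :
    X ◁ Δ ≫ (α_ X H H).inv ≫ (β_ X H).hom ▷ H ≫ (α_ H X H).hom ≫ H ◁ (ract ≫ rcoact) ≫
      (α_ H X H).inv ≫ (β_ H X).hom ▷ H ≫ (α_ X H H).hom ≫ X ◁ μ =
    (rcoact ⊗ₘ Δ) ≫ tensorμ X H H H ≫ (ract ⊗ₘ μ)

namespace CrossedModule
section
variable {H : C} [BimonObj H]

/-- Morphisms of crossed modules: module and comodule morphisms. -/
@[ext]
structure Hom (X Y : CrossedModule H) where
  hom : X.X ⟶ Y.X
  ract_hom : X.ract ≫ hom = hom ▷ H ≫ Y.ract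
  hom_rcoact : hom ≫ Y.rcoact = X.rcoact ≫ hom ▷ H

instance : Category (CrossedModule H) where
  Hom := Hom
  id X := ⟨𝟙 X.X, by simp, by simp⟩
  comp f g := ⟨f.hom ≫ g.hom, by simp [reassoc_of% f.ract_hom, g.ract_hom],
    by simp [← reassoc_of% f.hom_rcoact, g.hom_rcoact]⟩

@[simp] theorem id_hom (X : CrossedModule H) : Hom.hom (𝟙 X) = 𝟙 X.X := rfl

@[simp] theorem comp_hom {X Y Z : CrossedModule H} (f : X ⟶ Y) (g : Y ⟶ Z) :
    Hom.hom (f ≫ g) = Hom.hom f ≫ Hom.hom g := rfl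

@[ext] theorem hom_ext {X Y : CrossedModule H} {f g : X ⟶ Y} (h : Hom.hom f = Hom.hom g) :
    f = g :=
  Hom.ext h

/-- A subobject of a crossed module stable under action and coaction is a crossed module. -/
def ofMono (X : CrossedModule H) {K : C} (i : K ⟶ X.X) [Mono i]
    (hr : ∀ {A B : C} (f : A ⟶ B) [Mono f], Mono (f ▷ H))
    (r : K ⊗ H ⟶ K) (rc : K ⟶ K ⊗ H)
    (h₂ : r ≫ i = i ▷ H ≫ X.ract) (h₄ : rc ≫ i ▷ H = i ≫ X.rcoact) : CrossedModule H where
  X := K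
  ract := r
  rcoact := rc
  ract_one := by
    rw [← cancel_mono i, Category.assoc, h₂, whisker_exchange_assoc, X.ract_one,
      rightUnitor_naturality]
  ract_mul := by
    rw [← cancel_mono i]
    simp only [Category.assoc, h₂]
    rw [whisker_exchange_assoc, X.ract_mul, ← comp_whiskerRight_assoc, h₂]
    simp
  rcoact_counit := by
    have : Mono (i ▷ (𝟙_ C)) := by
      rw [MonoidalCategory.whiskerRight_id]
      infer_instance
    rw [← cancel_mono (i ▷ (𝟙_ C))]
    rw [Category.assoc, whisker_exchange, reassoc_of% h₄, X.rcoact_counit]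
    simp
  rcoact_comul := by
    have _ := hr i
    have : Mono (i ▷ (H ⊗ H)) := by
      rw [MonoidalCategory.whiskerRight_tensor]
      have _ := hr (i ▷ H)
      infer_instance
    rw [← cancel_mono (i ▷ (H ⊗ H))]
    simp only [Category.assoc]
    rw [whisker_exchange, reassoc_of% h₄, X.rcoact_comul, ← associator_naturality_left,
      ← comp_whiskerRight_assoc, h₄, comp_whiskerRight, Category.assoc, reassoc_of% h₄]
  crossed := by
    have _ := hr i
    rw [← cancel_mono (i ▷ H)]
    have h₂' : r ≫ i = (i ⊗ₘ 𝟙 H) ≫ X.ract := by rw [h₂, tensorHom_id]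
    have hR : ((rc ⊗ₘ Δ) ≫ tensorμ K H H H ≫ (r ⊗ₘ μ)) ≫ i ▷ H =
        i ▷ H ≫ (X.rcoact ⊗ₘ Δ) ≫ tensorμ X.X H H H ≫ (X.ract ⊗ₘ μ) := by
      simp only [Category.assoc]
      rw [← tensorHom_id i H, tensorHom_comp_tensorHom_assoc, Category.id_comp, ← h₄,
        ← tensorHom_id i H, tensorHom_comp_tensorHom, Category.comp_id, h₂',
        ← Category.comp_id (Δ[H]),
        ← tensorHom_comp_tensorHom_assoc, ← id_tensorHom_id, tensorμ_natural_assoc,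
        tensorHom_comp_tensorHom]
      simp
    rw [hR, ← X.crossed]
    simp only [Category.assoc]
    rw [whisker_exchange, ← associator_naturality_left_assoc, ← comp_whiskerRight_assoc,
      ← BraidedCategory.braiding_naturality_right, comp_whiskerRight_assoc,
      ← associator_inv_naturality_middle_assoc, ← MonoidalCategory.whiskerLeft_comp_assoc,
      Category.assoc, h₄, reassoc_of% h₂, ← whisker_exchange_assoc,
      associator_inv_naturality_left_assoc, ← comp_whiskerRight_assoc (i ▷ H),
      BraidedCategory.braiding_naturality_left]
    simp

variable (H) in
/-- The unit object with the trivial action `ε` and the trivial coaction `η`. -/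
def trivial : CrossedModule H where
  X := 𝟙_ C
  ract := (λ_ H).hom ≫ ε
  rcoact := η ≫ (λ_ H).inv
  ract_one := by
    rw [leftUnitor_naturality_assoc, BimonObj.one_counit]
    simp [unitors_equal]
  ract_mul := by
    rw [leftUnitor_naturality_assoc, BimonObj.mul_counit, Comon.tensorObj_counit,
      MonoidalCategory.tensorHom_def]
    simp
  rcoact_counit := by
    rw [Category.assoc, ← leftUnitor_inv_naturality, BimonObj.one_counit_assoc]
    simp [unitors_inv_equal]
  rcoact_comul := by
    rw [Category.assoc, ← leftUnitor_inv_naturality, BimonObj.one_comul_assoc,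
      MonObj.tensorObj.one_def, MonoidalCategory.tensorHom_def']
    simp only [comp_whiskerRight, Category.assoc]
    rw [← leftUnitor_inv_naturality_assoc η[H]]
    simp
  crossed := by
    have e1 : (𝟙_ C) ◁ Δ ≫ (α_ (𝟙_ C) H H).inv ≫ (β_ (𝟙_ C) H).hom ▷ H ≫
        (α_ H (𝟙_ C) H).hom = (λ_ H).hom ≫ Δ ≫ H ◁ (λ_ H).inv := by
      rw [braiding_tensorUnit_left]
      monoidal
    have e2 : (α_ H (𝟙_ C) H).inv ≫ (β_ H (𝟙_ C)).hom ▷ H ≫ (α_ (𝟙_ C) H H).hom ≫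
        (𝟙_ C) ◁ μ = H ◁ (λ_ H).hom ≫ μ ≫ (λ_ H).inv := by
      rw [braiding_tensorUnit_right]
      monoidal
    have hL : (λ_ H).hom ≫ Δ ≫ H ◁ (λ_ H).inv ≫ H ◁ (((λ_ H).hom ≫ ε) ≫ η ≫ (λ_ H).inv) ≫
        H ◁ (λ_ H).hom ≫ μ ≫ (λ_ H).inv = 𝟙 _ := by
      simp only [← MonoidalCategory.whiskerLeft_comp_assoc, Category.assoc, Iso.inv_hom_id,
        Iso.inv_hom_id_assoc, Category.comp_id]
      rw [MonoidalCategory.whiskerLeft_comp_assoc, MonObj.mul_one_assoc,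
        ComonObj.comul_counit_assoc]
      simp
    have h1 : η[H] ≫ (λ_ H).inv = (λ_ (𝟙_ C)).inv ≫ (𝟙 (𝟙_ C) ⊗ₘ η[H]) := by
      simp
    have h2 := tensorμ_natural (𝟙 (𝟙_ C)) η[H] (𝟙 H) (𝟙 H)
    rw [id_tensorHom_id] at h2
    rw [reassoc_of% e1, e2, hL, h1, ← Category.comp_id Δ[H], ← id_tensorHom_id,
      ← tensorHom_comp_tensorHom_assoc, reassoc_of% h2, tensorHom_comp_tensorHom,
      tensorHom_id η[H], MonObj.one_mul]
    simp only [tensorμ, braiding_tensorUnit_left]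
    have h3 : ((α_ (𝟙_ C) (𝟙_ C) (H ⊗ H)).hom ≫ 𝟙_ C ◁ (α_ (𝟙_ C) H H).inv ≫
        𝟙_ C ◁ ((λ_ H).hom ≫ (ρ_ H).inv) ▷ H ≫ 𝟙_ C ◁ (α_ H (𝟙_ C) H).hom ≫
        (α_ (𝟙_ C) H (𝟙_ C ⊗ H)).inv) ≫ (λ_ H).hom ▷ (𝟙_ C ⊗ H) ≫ H ◁ (λ_ H).hom =
        (λ_ (𝟙_ C)).hom ▷ (H ⊗ H) ≫ (λ_ (H ⊗ H)).hom := by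
      monoidal
    have h4 : ((λ_ H).hom ≫ ε[H] ⊗ₘ (λ_ H).hom) =
        ((λ_ H).hom ▷ (𝟙_ C ⊗ H) ≫ H ◁ (λ_ H).hom) ≫ ε[H] ▷ H := by
      rw [← MonoidalCategory.tensorHom_def, ← tensorHom_id, tensorHom_comp_tensorHom,
        Category.comp_id]
    simp only [Category.assoc] at h3
    rw [id_tensorHom_id, Category.id_comp, h4]
    simp only [Category.assoc]
    rw [reassoc_of% h3, MonoidalCategory.tensorHom_def']
    simp

end

variable (H : C) [HopfObj H]

/-- `H` with its regular right action and the right coadjoint coaction. -/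
def coadjoint : CrossedModule H where
  X := H
  ract := μ
  rcoact := coadj H
  ract_one := by simp
  ract_mul := by simp
  rcoact_counit := coadj_counit H
  rcoact_comul := by rw [reassoc_of% coadj_coassoc]; simp
  crossed := coadj_crossed H

/-- The counit as a morphism of crossed modules. -/
def counitHom : coadjoint H ⟶ trivial H where
  hom := ε[H]
  ract_hom := by simp [coadjoint, trivial, MonoidalCategory.tensorHom_def]
  hom_rcoact := by simp [coadjoint, trivial, coadj_counit_left]

end CrossedModule

section Flat

/-- A monoidal category is tensor-factor if tensor products of epimorphisms are epimorphisms and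
tensor products of monomorphisms are monomorphisms. -/
class TensorFactor (C : Type u) [Category.{v} C] [MonoidalCategory C] : Prop where
  epi_tensorHom : ∀ {X₁ Y₁ X₂ Y₂ : C} (f : X₁ ⟶ Y₁) (g : X₂ ⟶ Y₂) [Epi f] [Epi g], Epi (f ⊗ₘ g)
  mono_tensorHom : ∀ {X₁ Y₁ X₂ Y₂ : C} (f : X₁ ⟶ Y₁) (g : X₂ ⟶ Y₂) [Mono f] [Mono g],
    Mono (f ⊗ₘ g)

/-- An object of a braided abelian category is flat if the functor `H ⊗ -` is exact. -/
class IsFlat (H : C) : Prop where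
  preservesFiniteLimits : PreservesFiniteLimits (tensorLeft H)
  preservesFiniteColimits : PreservesFiniteColimits (tensorLeft H)

attribute [instance] IsFlat.preservesFiniteLimits IsFlat.preservesFiniteColimits

theorem IsFlat.mono_left (H : C) [IsFlat H] {A B : C} (f : A ⟶ B) [Mono f] : Mono (H ◁ f) :=
  inferInstanceAs (Mono ((tensorLeft H).map f))

theorem IsFlat.mono_right (H : C) [IsFlat H] {A B : C} (f : A ⟶ B) [Mono f] : Mono (f ▷ H) := by
  have _ := IsFlat.mono_left H f
  have : f ▷ H = (β_ A H).hom ≫ H ◁ f ≫ (β_ B H).inv := by simp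
  rw [this]
  infer_instance

variable [Abelian C] [MonoidalPreadditive C] (H : C) [IsFlat H]

/-- The lift of a morphism along `H ⊗ ker f = ker (H ⊗ f)`. -/
noncomputable def liftLeft {W A B : C} (f : A ⟶ B) (g : W ⟶ H ⊗ A) (h : g ≫ H ◁ f = 0) :
    W ⟶ H ⊗ kernel f :=
  kernel.lift ((tensorLeft H).map f) g h ≫ (PreservesKernel.iso (tensorLeft H) f).inv

theorem liftLeft_ι {W A B : C} (f : A ⟶ B) (g : W ⟶ H ⊗ A) (h : g ≫ H ◁ f = 0) :
    liftLeft H f g h ≫ H ◁ kernel.ι f = g := by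
  have := PreservesKernel.iso_inv_ι (tensorLeft H) f
  simpa [liftLeft] using
    congrArg (fun k => kernel.lift ((tensorLeft H).map f) g h ≫ k) this

/-- The lift of a morphism along `ker f ⊗ H = ker (f ⊗ H)`. -/
noncomputable def liftRight {W A B : C} (f : A ⟶ B) (g : W ⟶ A ⊗ H) (h : g ≫ f ▷ H = 0) :
    W ⟶ kernel f ⊗ H :=
  liftLeft H f (g ≫ (β_ A H).hom) (by
    rw [Category.assoc, ← BraidedCategory.braiding_naturality_left, reassoc_of% h, zero_comp]) ≫
    (β_ (kernel f) H).inv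

theorem liftRight_ι {W A B : C} (f : A ⟶ B) (g : W ⟶ A ⊗ H) (h : g ≫ f ▷ H = 0) :
    liftRight H f g h ≫ kernel.ι f ▷ H = g := by
  rw [liftRight, Category.assoc, ← BraidedCategory.braiding_inv_naturality_right,
    reassoc_of% liftLeft_ι]
  simp

variable {H}

theorem HopfBimod.lcoact_ker [BimonObj H] {X Y : HopfBimod H} (f : X ⟶ Y) :
    (kernel.ι f.hom ≫ X.lcoact) ≫ H ◁ f.hom = 0 := by
  rw [Category.assoc, ← f.hom_lcoact, kernel.condition_assoc, zero_comp]

theorem HopfBimod.rcoact_ker [BimonObj H] {X Y : HopfBimod H} (f : X ⟶ Y) :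
    (kernel.ι f.hom ≫ X.rcoact) ≫ f.hom ▷ H = 0 := by
  rw [Category.assoc, ← f.hom_rcoact, kernel.condition_assoc, zero_comp]

theorem CrossedModule.rcoact_ker [BimonObj H] {X Y : CrossedModule H} (f : X ⟶ Y) :
    (kernel.ι f.hom ≫ X.rcoact) ≫ f.hom ▷ H = 0 := by
  rw [Category.assoc, ← f.hom_rcoact, kernel.condition_assoc, zero_comp]

/-- The kernel in `C` of a morphism of Hopf bimodules, with the restricted structure. -/
noncomputable def HopfBimod.ker [BimonObj H] {X Y : HopfBimod H} (f : X ⟶ Y) : HopfBimod H :=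
  HopfBimod.ofMono X (kernel.ι f.hom) (IsFlat.mono_left H) (IsFlat.mono_right H)
    (kernel.lift f.hom (H ◁ kernel.ι f.hom ≫ X.lact) (by
      rw [Category.assoc, f.lact_hom, ← MonoidalCategory.whiskerLeft_comp_assoc]; simp))
    (kernel.lift f.hom (kernel.ι f.hom ▷ H ≫ X.ract) (by
      rw [Category.assoc, f.ract_hom, ← comp_whiskerRight_assoc]; simp))
    (liftLeft H f.hom (kernel.ι f.hom ≫ X.lcoact) (lcoact_ker f))
    (liftRight H f.hom (kernel.ι f.hom ≫ X.rcoact) (rcoact_ker f))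
    (by simp) (by simp) (liftLeft_ι ..) (liftRight_ι ..)

/-- The inclusion of the kernel. -/
noncomputable def HopfBimod.kerι [BimonObj H] {X Y : HopfBimod H} (f : X ⟶ Y) : ker f ⟶ X where
  hom := kernel.ι f.hom
  lact_hom := kernel.lift_ι ..
  ract_hom := kernel.lift_ι ..
  hom_lcoact := (liftLeft_ι H f.hom (kernel.ι f.hom ≫ X.lcoact) (lcoact_ker f)).symm
  hom_rcoact := (liftRight_ι H f.hom (kernel.ι f.hom ≫ X.rcoact) (rcoact_ker f)).symm

/-- The kernel in `C` of a morphism of crossed modules, with the restricted structure. -/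
noncomputable def CrossedModule.ker [BimonObj H] {X Y : CrossedModule H} (f : X ⟶ Y) :
    CrossedModule H :=
  CrossedModule.ofMono X (kernel.ι f.hom) (IsFlat.mono_right H)
    (kernel.lift f.hom (kernel.ι f.hom ▷ H ≫ X.ract) (by
      rw [Category.assoc, f.ract_hom, ← comp_whiskerRight_assoc]; simp))
    (liftRight H f.hom (kernel.ι f.hom ≫ X.rcoact) (rcoact_ker f))
    (by simp) (liftRight_ι ..)

/-- The inclusion of the kernel. -/
noncomputable def CrossedModule.kerι [BimonObj H] {X Y : CrossedModule H} (f : X ⟶ Y) :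
    ker f ⟶ X where
  hom := kernel.ι f.hom
  ract_hom := kernel.lift_ι ..
  hom_rcoact := (liftRight_ι H f.hom (kernel.ι f.hom ≫ X.rcoact) (rcoact_ker f)).symm

variable (H)

/-- The Hopf bimodule `Ker (μ : H ⊗ H ⟶ H)`. -/
noncomputable def H₂ [BimonObj H] : HopfBimod H := HopfBimod.ker (HopfBimod.mulHom H)

/-- The crossed module `Ker (ε : H ⟶ 𝟙_)`, a sub crossed module of the coadjoint one. -/
noncomputable def kerCounit [HopfObj H] : CrossedModule H :=
  CrossedModule.ker (CrossedModule.counitHom H)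

/-- The universal derivation: its composite with the inclusion into `H ⊗ H` is
`η ⊗ id - id ⊗ η`. -/
noncomputable def D [BimonObj H] : H ⟶ (H₂ H).X :=
  kernel.lift (HopfBimod.mulHom H).hom
    ((λ_ H).inv ≫ η[H] ▷ H - (ρ_ H).inv ≫ H ◁ η[H])
    (by
      change ((λ_ H).inv ≫ η[H] ▷ H - (ρ_ H).inv ≫ H ◁ η[H]) ≫ μ[H] = 0
      simp [Preadditive.sub_comp])

end Flat

/-- Bicovariant first order differential calculi over `H`: a Hopf bimodule `Ω` with a derivation
`d : H ⟶ Ω` that is a bicomodule morphism (`H` coacting on itself by `Δ`) and such that `Ω` is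
generated by the image of `d` as a left module. -/
structure BicovariantFODC [Abelian C] (H : C) [BimonObj H] where
  Ω : HopfBimod H
  d : H ⟶ Ω.X
  leibniz : μ ≫ d = d ▷ H ≫ Ω.ract + H ◁ d ≫ Ω.lact
  generated : imageSubobject (H ◁ d ≫ Ω.lact) = ⊤
  d_lcoact : d ≫ Ω.lcoact = Δ ≫ H ◁ d
  d_rcoact : d ≫ Ω.rcoact = Δ ≫ d ▷ H

namespace BicovariantFODC
variable [Abelian C] {H : C} [BimonObj H]

/-- Morphisms of calculi that are the identity on `H`. -/
@[ext]
structure Hom (Γ Γ' : BicovariantFODC H) where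
  f : Γ.Ω ⟶ Γ'.Ω
  d_f : Γ.d ≫ f.hom = Γ'.d

instance : Category (BicovariantFODC H) where
  Hom := Hom
  id Γ := ⟨𝟙 Γ.Ω, by simp⟩
  comp F G := ⟨F.f ≫ G.f, by simp [reassoc_of% F.d_f, G.d_f]⟩

variable (H) in
/-- Isomorphism classes of bicovariant first order differential calculi over `H`. -/
abbrev IsoClass := Quotient (isIsomorphicSetoid (BicovariantFODC H))

end BicovariantFODC

/-- Hopf sub-bimodules of `X`: subobjects in `C` represented by a morphism of Hopf bimodules. -/
def HopfSubbimodule {H : C} [BimonObj H] (X : HopfBimod H) :=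
  {N : Subobject X.X // ∃ (Y : HopfBimod H) (i : Y ⟶ X) (_ : Mono i.hom), Subobject.mk i.hom = N}

/-- Crossed submodules of `X`: subobjects in `C` represented by a morphism of crossed modules. -/
def CrossedSubmodule {H : C} [BimonObj H] (X : CrossedModule H) :=
  {M : Subobject X.X //
    ∃ (Y : CrossedModule H) (i : Y ⟶ X) (_ : Mono i.hom), Subobject.mk i.hom = M}

/-- The morphism `g ⊗ h ↦ g h₁ ⊗ h₂`. -/
def θ (H : C) [BimonObj H] : H ⊗ H ⟶ H ⊗ H := H ◁ Δ ≫ (α_ H H H).inv ≫ μ ▷ H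

end BraidedCalculus

open BraidedCalculus

/-! In element notation, `D h = 1 ⊗ h - h ⊗ 1` is a derivation into `Ker μ`. If `∑ g ⊗ h` lies in
`Ker μ`, then `∑ g · D h = ∑ g ⊗ h`, so `D` generates `Ker μ` as a left module and a morphism out of
`Ker μ` is determined by its composite with `D` (`hom_ext_D`). Conversely, for a calculus `(Ω, d)`
the map `g ⊗ h ↦ g d(h)`, restricted to `Ker μ`, is a morphism of Hopf bimodules sending `D` to `d`;
it is epi because `d` generates `Ω`. Calculi up to isomorphism are therefore the quotient Hopf
bimodules of `Ker μ`, and these correspond to Hopf sub-bimodules by taking kernels and cokernels,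
which inherit the structure because `H` is flat.

The passage from Hopf sub-bimodules `N` to crossed submodules is `M = (ε ⊗ id)(N)`. The isomorphism
`θ` trivializes `H ⊗ H` as a left Hopf module: its inverse is `g ⊗ h ↦ g · antidiag h`, where
`antidiag h = S(h₁) ⊗ h₂` is left coinvariant, and it carries `Ker μ` to `H ⊗ Ker ε`. The main point
is `θ(N) = H ⊗ M` (`imageSubobject_sqHom_θ`). The inclusion `⊆` holds because `θ` is the left
coaction followed by `id ⊗ (ε ⊗ id)`. For `⊇`, the projection `x ↦ S(x₋₁) x₀` preserves `N` and
equals `antidiag ∘ (ε ⊗ id)`, so `antidiag(M) ⊆ N`. Thus `M` determines `N`. Every crossed submodule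
`M` occurs, since the coadjoint coaction is the right coaction of `H ⊗ H` transported along
`antidiag`, so that `θ⁻¹(H ⊗ M)` is a Hopf sub-bimodule. -/

namespace BraidedCalculus

set_option linter.unusedSectionVars false
set_option linter.style.longLine false

/-! ### The isomorphism `θ` and the left coinvariants of `H ⊗ H`. -/

section Theta

variable {C : Type u} [Category.{v} C] [MonoidalCategory C] [BraidedCategory C]

attribute [local instance] isMonHom_one isMonHom_incR isMonHom_incL isMonHom_counit
  isMonHom_comul isComonHom_mul isComonHom_prL

theorem comul_whiskerLeft_prR (A B : C) [ComonObj A] [ComonObj B] :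
    Δ[A ⊗ B] ≫ (A ⊗ B) ◁ prR A B = A ◁ Δ ≫ (α_ A B B).inv := by
  have h := tensorμ_natural (𝟙 A) ε[A] (𝟙 B) (𝟙 B)
  simp only [tensorHom_id, id_whiskerRight, id_tensorHom] at h
  rw [prR, MonoidalCategory.whiskerLeft_comp, Comon.tensorObj_comul, Category.assoc, ← reassoc_of% h,
    MonoidalCategory.tensorHom_def'_assoc, ← comp_whiskerRight_assoc, ComonObj.comul_counit]
  simp only [tensorμ, braiding_tensorUnit_left]
  monoidal

theorem isComonHom_prR (A B : C) [ComonObj A] [ComonObj B] : IsComonHom (prR A B) where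
  hom_counit := by simp [prR, MonoidalCategory.tensorHom_def, unitors_equal, unitors_inv_equal]
  hom_comul := by
    rw [MonoidalCategory.tensorHom_def', ← Category.assoc, comul_whiskerLeft_prR, prR]
    simp only [Category.assoc, comp_whiskerRight]
    rw [← leftUnitor_naturality, ← whisker_exchange_assoc]
    monoidal

attribute [local instance] isComonHom_prR

variable (H : C) [HopfObj H]

/-- The morphism `h ↦ S(h₁) ⊗ h₂`, with values in the left coinvariants of `H ⊗ H`. -/
def antidiag : H ⟶ H ⊗ H := Δ ≫ 𝒮 ▷ H

theorem antidiag_eq : antidiag H = conv (𝒮 ≫ incL H H) (incR H H) := by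
  have : (𝒮 ≫ incL H H ⊗ₘ incR H H) = 𝒮 ▷ H ≫ (incL H H ⊗ₘ incR H H) := by
    rw [← tensorHom_id, tensorHom_comp_tensorHom, Category.id_comp]
  rw [conv, this, Category.assoc, incL_incR_mul, Category.comp_id, antidiag]

theorem incL_conv_inv : conv (incL H H) (𝒮 ≫ incL H H) = ε ≫ η := by
  have := conv_comp (𝟙 H) 𝒮[H] (incL H H)
  rw [Category.id_comp] at this
  rw [← this, conv, id_tensorHom]
  simp

theorem inv_conv_incL : conv (𝒮 ≫ incL H H) (incL H H) = ε ≫ η := by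
  have := conv_comp 𝒮[H] (𝟙 H) (incL H H)
  rw [Category.id_comp] at this
  rw [← this, conv, tensorHom_id]
  simp

theorem incL_conv_antidiag : conv (incL H H) (antidiag H) = incR H H := by
  rw [antidiag_eq, ← conv_assoc, incL_conv_inv, one_conv]

open HopfBimod

/-- The left action of `square H`. -/
def sqLact : H ⊗ (H ⊗ H) ⟶ H ⊗ H := (α_ H H H).inv ≫ μ ▷ H
/-- The right action of `square H`. -/
def sqRact : (H ⊗ H) ⊗ H ⟶ H ⊗ H := (α_ H H H).hom ≫ H ◁ μ
/-- The left coaction of `square H`. -/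
def sqLcoact : H ⊗ H ⟶ H ⊗ (H ⊗ H) := Δ[H ⊗ H] ≫ μ ▷ (H ⊗ H)
/-- The right coaction of `square H`. -/
def sqRcoact : H ⊗ H ⟶ (H ⊗ H) ⊗ H := Δ[H ⊗ H] ≫ (H ⊗ H) ◁ μ

theorem square_lact : (square H).lact = sqLact H := rfl

theorem square_ract : (square H).ract = sqRact H := rfl

theorem square_lcoact : (square H).lcoact = sqLcoact H := by
  rw [sqLcoact, Comon.tensorObj_comul, Category.assoc]; rfl

theorem square_rcoact : (square H).rcoact = sqRcoact H := by
  rw [sqRcoact, Comon.tensorObj_comul, Category.assoc]; rfl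

theorem sqLact_eq : sqLact H = incL H H ▷ (H ⊗ H) ≫ μ := by
  rw [incL_mul]; rfl

theorem mul_sqLact : μ ▷ (H ⊗ H) ≫ sqLact H = (α_ H H (H ⊗ H)).hom ≫ H ◁ sqLact H ≫ sqLact H :=
  (square H).mul_lact

theorem sqLcoact_comul :
    sqLcoact H ≫ Δ ▷ (H ⊗ H) = sqLcoact H ≫ H ◁ sqLcoact H ≫ (α_ H H (H ⊗ H)).inv := by
  have h := (square H).lcoact_comul
  simp only [square_lcoact] at h
  exact h

theorem sqLcoact_sqRcoact :
    sqRcoact H ≫ sqLcoact H ▷ H = sqLcoact H ≫ H ◁ sqRcoact H ≫ (α_ H (H ⊗ H) H).inv := by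
  have h := (square H).lcoact_rcoact
  simp only [square_lcoact, square_rcoact] at h
  exact h

theorem sqLact_sqRcoact :
    sqLact H ≫ sqRcoact H = (Δ ⊗ₘ sqRcoact H) ≫ tensorμ H H (H ⊗ H) H ≫ (sqLact H ⊗ₘ μ) := by
  have h := (square H).lact_rcoact
  simp only [square_lact, square_rcoact] at h
  exact h

theorem sqRact_sqLcoact :
    sqRact H ≫ sqLcoact H = (sqLcoact H ⊗ₘ Δ) ≫ tensorμ H (H ⊗ H) H H ≫ (μ ⊗ₘ sqRact H) := by
  have h := (square H).ract_lcoact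
  simp only [square_lcoact, square_ract] at h
  exact h

theorem conv_incL {M : C} [ComonObj M] (f : M ⟶ H) (g : M ⟶ H ⊗ H) :
    conv (f ≫ incL H H) g = Δ ≫ f ▷ M ≫ H ◁ g ≫ sqLact H := by
  rw [conv, sqLact_eq, MonoidalCategory.tensorHom_def, comp_whiskerRight]
  simp only [Category.assoc]
  rw [whisker_exchange_assoc]

/-- `S(x₋₁) x₀`, the projection of `H ⊗ H` onto its left coinvariants. -/
theorem sq_coinvariants_projection :
    sqLcoact H ≫ 𝒮 ▷ (H ⊗ H) ≫ sqLact H = prR H H ≫ antidiag H := by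
  have h1 : sqLcoact H ≫ 𝒮 ▷ (H ⊗ H) ≫ sqLact H =
      conv (μ ≫ 𝒮 ≫ incL H H) (𝟙 _) := by
    have := conv_incL H (μ[H] ≫ 𝒮) (𝟙 (H ⊗ H))
    rw [Category.assoc] at this
    rw [this, sqLcoact, MonoidalCategory.whiskerLeft_id, Category.id_comp, comp_whiskerRight]
    simp only [Category.assoc]
  have hp : conv (prL H H) (prR H H) = μ := by
    rw [conv, reassoc_of% (comul_prL_prR H H)]
  have h3 : conv (prL H H ≫ incL H H) (prR H H ≫ incR H H) = 𝟙 _ := by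
    rw [conv, ← tensorHom_comp_tensorHom, Category.assoc, incL_incR_mul, Category.comp_id,
      comul_prL_prR]
  -- Multiplying by the convolution-invertible `μ ≫ incL` turns both sides into the identity of `H ⊗
  -- H`; on the right this uses that `μ` is the convolution product of the two projections.
  refine conv_cancel (a := μ ≫ incL H H) (b := μ ≫ 𝒮 ≫ incL H H) ?_ ?_
  · rw [← comp_conv, inv_conv_incL, IsComonHom.hom_counit_assoc]
  · rw [h1, ← conv_assoc, ← comp_conv, incL_conv_inv, IsComonHom.hom_counit_assoc, one_conv]
    rw [← hp, conv_comp, conv_assoc, ← comp_conv, incL_conv_antidiag, h3]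

theorem θ_eq_lact : θ H = H ◁ Δ ≫ sqLact H := rfl

/-- This form uses only the left coaction, so it restricts to every Hopf sub-bimodule `N` and shows
`θ(N) ⊆ H ⊗ (ε ⊗ id)(N)`. -/
theorem θ_eq_lcoact : θ H = sqLcoact H ≫ H ◁ prR H H := by
  rw [sqLcoact, Category.assoc, ← whisker_exchange, reassoc_of% comul_whiskerLeft_prR, θ]

theorem antidiag_θ : antidiag H ≫ θ H = incR H H := by
  have : 𝒮 ▷ H ≫ H ◁ Δ ≫ (α_ H H H).inv ≫ μ ▷ H =
      H ◁ Δ ≫ (α_ H H H).inv ≫ (𝒮 ▷ H ≫ μ) ▷ H := by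
    rw [← whisker_exchange_assoc]; simp
  rw [antidiag, θ, Category.assoc, this, ComonObj.comul_assoc_assoc]
  simp only [Iso.hom_inv_id_assoc, ← comp_whiskerRight]
  rw [HopfObj.antipode_left, comp_whiskerRight, ComonObj.counit_comul_assoc, incR]

/-- The inverse of `θ`: `g ⊗ h ↦ g S(h₁) ⊗ h₂`. -/
def θInv : H ⊗ H ⟶ H ⊗ H := H ◁ antidiag H ≫ sqLact H

theorem whiskerLeft_incR_lact : H ◁ incR H H ≫ sqLact H = 𝟙 _ := by
  rw [sqLact, incR, MonoidalCategory.whiskerLeft_comp, Category.assoc,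
    associator_inv_naturality_middle_assoc, ← comp_whiskerRight, MonObj.mul_one]
  monoidal

/-- Left-linear maps out of free modules compose on generators. It reduces the two inverse laws for
`θ` to computing `antidiag ≫ θ` and `Δ ≫ θInv`, both equal to `incR`. -/
theorem whiskerLeft_lact {W V : C} (f : W ⟶ H ⊗ V) (g : V ⟶ H ⊗ H) :
    H ◁ f ≫ (α_ H H V).inv ≫ μ ▷ V ≫ H ◁ g ≫ sqLact H =
      H ◁ (f ≫ H ◁ g ≫ sqLact H) ≫ sqLact H := by
  rw [← whisker_exchange_assoc, mul_sqLact]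
  simp

theorem θ_θInv : θ H ≫ θInv H = 𝟙 _ := by
  have := whiskerLeft_lact H Δ (antidiag H)
  have h2 := conv_incL H (𝟙 H) (antidiag H)
  rw [Category.id_comp, incL_conv_antidiag] at h2
  simp only [id_whiskerRight, Category.id_comp] at h2
  rw [← h2, whiskerLeft_incR_lact] at this
  simpa [θ, θInv, sqLact] using this

theorem θInv_θ : θInv H ≫ θ H = 𝟙 _ := by
  have := whiskerLeft_lact H (antidiag H) Δ
  rw [← θ_eq_lact, antidiag_θ, whiskerLeft_incR_lact] at this
  rw [← this]
  simp [θ, θInv, sqLact]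

instance : IsIso (θ H) := ⟨θInv H, θ_θInv H, θInv_θ H⟩

theorem θ_prR : θ H ≫ prR H H = prR H H := by
  rw [θ, prR]
  simp only [Category.assoc, ← comp_whiskerRight_assoc, BimonObj.mul_counit, Comon.tensorObj_counit]
  rw [MonoidalCategory.tensorHom_def', comp_whiskerRight, comp_whiskerRight, Category.assoc,
    Category.assoc, ← associator_inv_naturality_middle_assoc,
    ← MonoidalCategory.whiskerLeft_comp_assoc, ComonObj.counit_comul]
  monoidal

theorem θInv_prR : θInv H ≫ prR H H = prR H H := by
  rw [← θ_prR, ← Category.assoc, θInv_θ, Category.id_comp, θ_prR]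

theorem prR_counit : prR H H ≫ ε = μ ≫ ε := by
  simp [prR, MonoidalCategory.tensorHom_def]

/-- Coassociativity makes `θ` left colinear, with target the cofree comodule on the right factor. -/
theorem θ_lcoact : θ H ≫ Δ ▷ H ≫ (α_ H H H).hom = sqLcoact H ≫ H ◁ θ H := by
  have h := sqLcoact_comul H
  rw [θ_eq_lcoact, Category.assoc, whisker_exchange_assoc, reassoc_of% h]
  simp

/-- Left coinvariance of `antidiag` is tested after `H ◁ θ`, where it becomes the evident
coinvariance of `1 ⊗ h`. -/
theorem antidiag_lcoact :
    antidiag H ≫ sqLcoact H = antidiag H ≫ (λ_ (H ⊗ H)).inv ≫ η ▷ (H ⊗ H) := by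
  have h : η[H] ▷ H ≫ Δ ▷ H =
      (λ_ H).hom ≫ incR H H ≫ (λ_ (H ⊗ H)).inv ≫ η ▷ (H ⊗ H) ≫ (α_ H H H).inv := by
    rw [← comp_whiskerRight, BimonObj.one_comul, MonObj.tensorObj.one_def, incR,
      MonoidalCategory.tensorHom_def']
    monoidal
  rw [← cancel_mono (H ◁ θ H), Category.assoc, ← θ_lcoact, reassoc_of% antidiag_θ, Category.assoc,
    Category.assoc, ← whisker_exchange, ← leftUnitor_inv_naturality_assoc, reassoc_of% antidiag_θ]
  nth_rw 1 [incR]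
  rw [Category.assoc, reassoc_of% h]
  simp

theorem ract_prR : sqRact H ≫ prR H H = prR H H ▷ H ≫ μ := by
  rw [sqRact, prR, Category.assoc, whisker_exchange_assoc]
  monoidal

/-- This is where the coadjoint coaction comes from: it is the right coaction of `H ⊗ H` read on
left coinvariants. -/
theorem antidiag_rcoact_prR :
    antidiag H ≫ sqRcoact H ≫ prR H H ▷ H = coadj H := by
  rw [sqRcoact, Category.assoc, whisker_exchange, reassoc_of% comul_prR, antidiag, coadj]
  rw [Category.assoc, ← whisker_exchange_assoc, associator_inv_naturality_left_assoc,
    ← comp_whiskerRight_assoc (𝒮 ▷ H), BraidedCategory.braiding_naturality_left]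
  simp

/-- Since the two coactions commute, the right coaction of a left coinvariant has left coinvariant
first leg, hence is recovered from its image under `prR`. -/
theorem antidiag_rcoact : antidiag H ≫ sqRcoact H = coadj H ≫ antidiag H ▷ H := by
  rw [← cancel_mono (θ H ▷ H), Category.assoc, Category.assoc, ← comp_whiskerRight (antidiag H),
    antidiag_θ, θ_eq_lcoact, comp_whiskerRight, reassoc_of% sqLcoact_sqRcoact,
    reassoc_of% antidiag_lcoact, ← associator_inv_naturality_middle,
    ← whisker_exchange_assoc, ← whisker_exchange_assoc, ← leftUnitor_inv_naturality_assoc,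
    ← leftUnitor_inv_naturality_assoc, ← antidiag_rcoact_prR, incR]
  simp

/-- Under `θ` the right action on the second factor becomes the diagonal one, because the left
coaction is right linear and so is `prR`. -/
theorem ract_θ : sqRact H ≫ θ H = (θ H ⊗ₘ Δ) ≫ tensorμ H H H H ≫ (μ ⊗ₘ μ) := by
  have h1 := θ_eq_lcoact H
  have h2 := tensorμ_natural (𝟙 H) (prR H H) (𝟙 H) (𝟙 H)
  rw [id_tensorHom_id] at h2
  rw [h1, reassoc_of% sqRact_sqLcoact, ← id_tensorHom, tensorHom_comp_tensorHom, Category.comp_id,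
    ract_prR, ← Category.comp_id Δ[H], ← tensorHom_comp_tensorHom, Category.assoc,
    reassoc_of% h2, tensorHom_comp_tensorHom, Category.id_comp, tensorHom_id, Category.comp_id]

/-- For this reason `θ` matches `Ker μ` with `H ⊗ Ker ε`. -/
theorem θ_prL : θ H ≫ prL H H = μ := by
  rw [θ, prL, Category.assoc, Category.assoc, ← whisker_exchange_assoc,
    ← associator_inv_naturality_right_assoc, ← MonoidalCategory.whiskerLeft_comp_assoc,
    ComonObj.comul_counit]
  monoidal

theorem θInv_mul : θInv H ≫ μ = prL H H := by
  rw [← θ_prL, ← Category.assoc, θInv_θ, Category.id_comp]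

end Theta

/-! ### Images and subobjects in an abelian category. -/

section Images

variable {C : Type u} [Category.{v} C] [Abelian C]

/-- Epis are strong here. This is how structure morphisms are induced on an image: they are known on
its source and on its target. -/
theorem exists_lift_of_epi_mono {A B K D : C} (e : A ⟶ B) [Epi e] (m : K ⟶ D) [Mono m]
    (f : A ⟶ K) (g : B ⟶ D) (h : f ≫ m = e ≫ g) : ∃ l : B ⟶ K, l ≫ m = g := by
  have := strongEpi_of_epi e
  have sq : CommSq f e m g := ⟨h⟩
  exact ⟨sq.lift, sq.fac_right⟩

theorem imageSubobject_epi_comp {A B D : C} (e : A ⟶ B) [Epi e] (f : B ⟶ D) :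
    imageSubobject (e ≫ f) = imageSubobject f := by
  refine le_antisymm (imageSubobject_comp_le e f) ?_
  obtain ⟨l, hl⟩ := exists_lift_of_epi_mono e (imageSubobject (e ≫ f)).arrow
    (factorThruImageSubobject (e ≫ f)) f (by simp)
  exact imageSubobject_le _ l hl

theorem imageSubobject_le_of_fac {A B D : C} (f : A ⟶ D) (g : B ⟶ D) (k : A ⟶ B)
    (h : k ≫ g = f) : imageSubobject f ≤ imageSubobject g := by
  subst h; exact imageSubobject_comp_le k g

theorem imageSubobject_mk_arrow_comp {A B D : C} (i : A ⟶ B) [Mono i] (f : B ⟶ D) :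
    imageSubobject ((Subobject.mk i).arrow ≫ f) = imageSubobject (i ≫ f) := by
  rw [← imageSubobject_epi_comp (Subobject.underlyingIso i).inv, Subobject.underlyingIso_arrow_assoc]

theorem mk_eq_of_imageSubobject_comp_eq {A B D E : C} (i : A ⟶ D) (j : B ⟶ D) [Mono i] [Mono j]
    (f : D ⟶ E) [Mono f] (h : imageSubobject (i ≫ f) = imageSubobject (j ≫ f)) :
    Subobject.mk i = Subobject.mk j := by
  rw [imageSubobject_mono, imageSubobject_mono] at h
  have key : ∀ {A B : C} (i : A ⟶ D) (j : B ⟶ D) [Mono i] [Mono j],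
      Subobject.mk (i ≫ f) = Subobject.mk (j ≫ f) → Subobject.mk i ≤ Subobject.mk j := by
    intro A B i j _ _ h
    refine Subobject.mk_le_mk_of_comm (Subobject.ofMkLEMk _ _ h.le) ?_
    rw [← cancel_mono f, Category.assoc, Subobject.ofMkLEMk_comp]
  exact le_antisymm (key i j h) (key j i h.symm)

end Images

/-! ### Hopf sub-bimodules of `Ker μ` and crossed submodules of `Ker ε`. -/

section

variable {C : Type u} [Category.{v} C] [MonoidalCategory C] [BraidedCategory C]

theorem IsFlat.epi_left [Abelian C] (H : C) [IsFlat H] {A B : C} (f : A ⟶ B) [Epi f] :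
    Epi (H ◁ f) :=
  inferInstanceAs (Epi ((tensorLeft H).map f))

theorem IsFlat.epi_right [Abelian C] (H : C) [IsFlat H] {A B : C} (f : A ⟶ B) [Epi f] :
    Epi (f ▷ H) := by
  have _ := IsFlat.epi_left H f
  have : f ▷ H = (β_ A H).hom ≫ H ◁ f ≫ (β_ B H).inv := by simp
  rw [this]
  infer_instance

variable [Abelian C] [MonoidalPreadditive C] (H : C) [HopfObj H] [IsFlat H]

/-- The inclusion of `H₂ H` in `H ⊗ H`. -/
noncomputable def H₂ι : (H₂ H).X ⟶ H ⊗ H := (HopfBimod.kerι (HopfBimod.mulHom H)).hom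

/-- The inclusion of the kernel of the counit in `H`. -/
noncomputable def kerCounitι : (kerCounit H).X ⟶ H :=
  (CrossedModule.kerι (CrossedModule.counitHom H)).hom

instance : Mono (H₂ι H) := equalizer.ι_mono (f := (HopfBimod.mulHom H).hom) (g := 0)

instance : Mono (kerCounitι H) :=
  equalizer.ι_mono (f := (CrossedModule.counitHom H).hom) (g := 0)

theorem H₂ι_mul : H₂ι H ≫ μ = 0 := kernel.condition (HopfBimod.mulHom H).hom

theorem kerCounitι_counit : kerCounitι H ≫ ε = 0 :=
  kernel.condition (CrossedModule.counitHom H).hom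

theorem exists_lift_H₂ {W : C} (f : W ⟶ H ⊗ H) (h : f ≫ μ = 0) :
    ∃ g : W ⟶ (H₂ H).X, g ≫ H₂ι H = f :=
  ⟨kernel.lift (HopfBimod.mulHom H).hom f h, kernel.lift_ι _ _ _⟩

theorem lact_H₂ι : (H₂ H).lact ≫ H₂ι H = H ◁ H₂ι H ≫ sqLact H :=
  (HopfBimod.kerι (HopfBimod.mulHom H)).lact_hom

theorem ract_H₂ι : (H₂ H).ract ≫ H₂ι H = H₂ι H ▷ H ≫ sqRact H :=
  (HopfBimod.kerι (HopfBimod.mulHom H)).ract_hom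

theorem H₂ι_lcoact : H₂ι H ≫ sqLcoact H = (H₂ H).lcoact ≫ H ◁ H₂ι H := by
  have h := (HopfBimod.kerι (HopfBimod.mulHom H)).hom_lcoact
  rw [square_lcoact] at h
  exact h

theorem H₂ι_rcoact : H₂ι H ≫ sqRcoact H = (H₂ H).rcoact ≫ H₂ι H ▷ H := by
  have h := (HopfBimod.kerι (HopfBimod.mulHom H)).hom_rcoact
  rw [square_rcoact] at h
  exact h

theorem ract_kerCounitι : (kerCounit H).ract ≫ kerCounitι H = kerCounitι H ▷ H ≫ μ :=
  (CrossedModule.kerι (CrossedModule.counitHom H)).ract_hom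

theorem kerCounitι_rcoact : kerCounitι H ≫ coadj H = (kerCounit H).rcoact ≫ kerCounitι H ▷ H :=
  (CrossedModule.kerι (CrossedModule.counitHom H)).hom_rcoact

/-- The restriction of `ε ⊗ id` to a morphism `Ker μ ⟶ Ker ε`. -/
noncomputable def prKer : (H₂ H).X ⟶ (kerCounit H).X :=
  kernel.lift (CrossedModule.counitHom H).hom (H₂ι H ≫ prR H H) (by
    change (H₂ι H ≫ prR H H) ≫ ε[H] = 0
    rw [Category.assoc, prR_counit, reassoc_of% H₂ι_mul, zero_comp])

theorem prKer_ι : prKer H ≫ kerCounitι H = H₂ι H ≫ prR H H := kernel.lift_ι _ _ _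

section Sub

variable {H} {Y : HopfBimod H} (i : Y ⟶ H₂ H)

/-- The inclusion of a Hopf sub-bimodule of `H₂ H` in `H ⊗ H`. -/
noncomputable def sqHom : Y.X ⟶ H ⊗ H := i.hom ≫ H₂ι H

theorem lact_sqHom : Y.lact ≫ sqHom i = H ◁ sqHom i ≫ sqLact H := by
  rw [sqHom, reassoc_of% i.lact_hom, lact_H₂ι, MonoidalCategory.whiskerLeft_comp, Category.assoc]

theorem ract_sqHom : Y.ract ≫ sqHom i = sqHom i ▷ H ≫ sqRact H := by
  rw [sqHom, reassoc_of% i.ract_hom, ract_H₂ι, comp_whiskerRight, Category.assoc]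

theorem sqHom_lcoact : sqHom i ≫ sqLcoact H = Y.lcoact ≫ H ◁ sqHom i := by
  rw [sqHom, Category.assoc, H₂ι_lcoact, reassoc_of% i.hom_lcoact,
    MonoidalCategory.whiskerLeft_comp]

theorem sqHom_rcoact : sqHom i ≫ sqRcoact H = Y.rcoact ≫ sqHom i ▷ H := by
  rw [sqHom, Category.assoc, H₂ι_rcoact, reassoc_of% i.hom_rcoact, comp_whiskerRight]

/-- The left factor is defined inside `Y`, so `antidiag` of anything in `(ε ⊗ id)(Y)` lies in `Y`
again. -/
theorem coinvariants_projection_sqHom :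
    (Y.lcoact ≫ 𝒮 ▷ Y.X ≫ Y.lact) ≫ sqHom i = sqHom i ≫ prR H H ≫ antidiag H := by
  rw [← sq_coinvariants_projection, reassoc_of% sqHom_lcoact, whisker_exchange_assoc,
    ← lact_sqHom]
  simp

theorem sqHom_θ : sqHom i ≫ θ H = Y.lcoact ≫ H ◁ (sqHom i ≫ prR H H) := by
  rw [θ_eq_lcoact, reassoc_of% sqHom_lcoact, MonoidalCategory.whiskerLeft_comp]

/-- The identity `θ(N) = H ⊗ M`, with `M` presented by any factorization of `prR` on `N` through an
epi. -/
theorem imageSubobject_sqHom_θ {K : C} (e : Y.X ⟶ K) (m : K ⟶ H) [Epi e]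
    (h : e ≫ m = sqHom i ≫ prR H H) :
    imageSubobject (sqHom i ≫ θ H) = imageSubobject (H ◁ m) := by
  have _ := IsFlat.epi_left H e
  apply le_antisymm
  · exact imageSubobject_le_of_fac _ _ (Y.lcoact ≫ H ◁ e) (by
      rw [sqHom_θ, ← h, MonoidalCategory.whiskerLeft_comp, Category.assoc])
  · rw [← imageSubobject_epi_comp (H ◁ e), ← MonoidalCategory.whiskerLeft_comp, h]
    -- The preimage of `g ⊗ prR y` under `θ` is `g · S(y₋₁) y₀`, which is formed inside `Y`.
    refine imageSubobject_le_of_fac _ _ (H ◁ (Y.lcoact ≫ 𝒮 ▷ Y.X ≫ Y.lact) ≫ Y.lact) ?_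
    have h2 := θInv_θ H
    rw [θInv, Category.assoc] at h2
    rw [Category.assoc, reassoc_of% lact_sqHom, ← MonoidalCategory.whiskerLeft_comp_assoc,
      coinvariants_projection_sqHom, ← Category.assoc (sqHom i),
      MonoidalCategory.whiskerLeft_comp, Category.assoc, h2, Category.comp_id]

theorem exists_crossedSubmodule :
    ∃ (M : CrossedModule H) (j : M ⟶ kerCounit H) (_ : Mono j.hom),
      Subobject.mk j.hom = imageSubobject (i.hom ≫ prKer H) := by
  let e := factorThruImage (i.hom ≫ prKer H)
  let m := image.ι (i.hom ≫ prKer H)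
  have hem : e ≫ m ≫ kerCounitι H = sqHom i ≫ prR H H := by
    rw [image.fac_assoc, Category.assoc, prKer_ι, sqHom, Category.assoc]
  have _ := IsFlat.epi_right H e
  have _ := IsFlat.mono_right H (kerCounitι H)
  have _ := IsFlat.mono_right H m
  -- The action restricts to the image because `prR` is right linear.
  obtain ⟨r, hr⟩ := exists_lift_of_epi_mono (e ▷ H) m (Y.ract ≫ e) (m ▷ H ≫ (kerCounit H).ract) (by
    rw [← cancel_mono (kerCounitι H)]
    simp only [Category.assoc]
    rw [hem, reassoc_of% ract_sqHom, ract_prR, ract_kerCounitι, ← comp_whiskerRight_assoc,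
      ← comp_whiskerRight_assoc, ← comp_whiskerRight_assoc, Category.assoc, hem])
  -- `prR` is not colinear on all of `Y`; the coadjoint coaction of `prR y` is obtained by first
  -- replacing `y` with the coinvariant `S(y₋₁) y₀`, then coacting in `Y` and projecting.
  obtain ⟨c, hc⟩ := exists_lift_of_epi_mono e (m ▷ H)
    ((Y.lcoact ≫ 𝒮 ▷ Y.X ≫ Y.lact) ≫ Y.rcoact ≫ e ▷ H) (m ≫ (kerCounit H).rcoact) (by
    rw [← cancel_mono (kerCounitι H ▷ H)]
    have hq := coinvariants_projection_sqHom i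
    generalize Y.lcoact ≫ 𝒮 ▷ Y.X ≫ Y.lact = q at hq
    simp only [Category.assoc]
    rw [← kerCounitι_rcoact, reassoc_of% hem, ← comp_whiskerRight, ← comp_whiskerRight, hem,
      comp_whiskerRight, ← reassoc_of% sqHom_rcoact, reassoc_of% hq, antidiag_rcoact_prR])
  exact ⟨CrossedModule.ofMono (kerCounit H) m (IsFlat.mono_right H) r c hr hc,
    ⟨m, hr, hc.symm⟩, inferInstanceAs (Mono m), rfl⟩

end Sub

section CoSub

variable {H} {M : CrossedModule H} (j : M ⟶ kerCounit H) [Mono j.hom]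

/-- The inclusion of `H ⊗ M` in `H ⊗ H`, for a crossed submodule `M` of `kerCounit H`. -/
noncomputable def θInvHom : H ⊗ M.X ⟶ H ⊗ H := H ◁ (j.hom ≫ kerCounitι H) ≫ θInv H

theorem θInvHom_θ : θInvHom j ≫ θ H = H ◁ (j.hom ≫ kerCounitι H) := by
  rw [θInvHom, Category.assoc, θInv_θ, Category.comp_id]

theorem θInvHom_mul : θInvHom j ≫ μ = 0 := by
  rw [θInvHom, Category.assoc, θInv_mul, prL, ← MonoidalCategory.whiskerLeft_comp_assoc,
    Category.assoc, kerCounitι_counit, comp_zero, MonoidalPreadditive.whiskerLeft_zero, zero_comp]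

theorem θInvHom_prR : θInvHom j ≫ prR H H = prR H M.X ≫ j.hom ≫ kerCounitι H := by
  rw [θInvHom, Category.assoc, θInv_prR, prR, whisker_exchange_assoc, leftUnitor_naturality, prR,
    Category.assoc]

theorem θInvHom_lact : ((α_ H H M.X).inv ≫ μ ▷ M.X) ≫ θInvHom j = H ◁ θInvHom j ≫ sqLact H := by
  rw [θInvHom, θInv, ← MonoidalCategory.whiskerLeft_comp_assoc, Category.assoc,
    ← whisker_exchange_assoc, mul_sqLact]
  simp

/-- Checked after the isomorphism `θ`, where the right action is diagonal and preserves `H ⊗ M`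
because `M` is a submodule. -/
theorem θInvHom_ract :
    ((H ⊗ M.X) ◁ Δ ≫ tensorμ H M.X H H ≫ (μ ⊗ₘ M.ract)) ≫ θInvHom j =
      θInvHom j ▷ H ≫ sqRact H := by
  have h := tensorμ_natural_left (𝟙 H) (j.hom ≫ kerCounitι H) H H
  rw [id_tensorHom] at h
  have hR : (H ◁ (j.hom ≫ kerCounitι H) ⊗ₘ Δ) ≫ tensorμ H H H H = (H ⊗ M.X) ◁ Δ ≫
      tensorμ H M.X H H ≫ (𝟙 H ▷ H ⊗ₘ (j.hom ≫ kerCounitι H) ▷ H) := by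
    rw [MonoidalCategory.tensorHom_def', Category.assoc, h]
  have hA : M.ract ≫ j.hom ≫ kerCounitι H = (j.hom ≫ kerCounitι H) ▷ H ≫ μ := by
    rw [reassoc_of% j.ract_hom, ract_kerCounitι, comp_whiskerRight, Category.assoc]
  rw [← cancel_mono (θ H), Category.assoc, Category.assoc, Category.assoc, θInvHom_θ,
    Category.assoc, ract_θ, ← tensorHom_id, tensorHom_comp_tensorHom_assoc, θInvHom_θ,
    Category.id_comp, reassoc_of% hR, tensorHom_comp_tensorHom, ← id_tensorHom H (j.hom ≫ _),
    tensorHom_comp_tensorHom, Category.comp_id, hA, id_whiskerRight, Category.id_comp]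

theorem θInvHom_lcoact :
    (Δ ▷ M.X ≫ (α_ H H M.X).hom) ≫ H ◁ θInvHom j = θInvHom j ≫ sqLcoact H := by
  have _ := IsFlat.mono_left H (θ H)
  rw [← cancel_mono (H ◁ θ H), Category.assoc, Category.assoc, Category.assoc, ← θ_lcoact,
    ← MonoidalCategory.whiskerLeft_comp, θInvHom_θ, reassoc_of% θInvHom_θ,
    whisker_exchange_assoc]
  simp

/-- Writing `θInv` as `g ⊗ h ↦ g · antidiag h`, this combines compatibility of left action and right
coaction with the colinearity of `antidiag`. -/
theorem θInvHom_rcoact :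
    ((Δ ⊗ₘ M.rcoact) ≫ tensorμ H H M.X H ≫ (H ⊗ M.X) ◁ μ) ≫ θInvHom j ▷ H =
      θInvHom j ≫ sqRcoact H := by
  have h := tensorμ_natural_right H H ((j.hom ≫ kerCounitι H) ≫ antidiag H) (𝟙 H)
  simp only [tensorHom_id] at h
  have h2 : ((j.hom ≫ kerCounitι H) ≫ antidiag H) ≫ sqRcoact H =
      M.rcoact ≫ ((j.hom ≫ kerCounitι H) ≫ antidiag H) ▷ H := by
    rw [Category.assoc, antidiag_rcoact, Category.assoc, reassoc_of% kerCounitι_rcoact,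
      reassoc_of% j.hom_rcoact]
    simp
  have e : θInvHom j = H ◁ ((j.hom ≫ kerCounitι H) ≫ antidiag H) ≫ sqLact H := by
    rw [θInvHom, θInv, ← MonoidalCategory.whiskerLeft_comp_assoc]
  rw [e]
  generalize (j.hom ≫ kerCounitι H) ≫ antidiag H = k at h h2
  have h3 : H ◁ k ≫ (Δ ⊗ₘ sqRcoact H) = (Δ ⊗ₘ M.rcoact) ≫ (H ⊗ H) ◁ k ▷ H := by
    rw [← id_tensorHom, ← id_tensorHom, tensorHom_comp_tensorHom, tensorHom_comp_tensorHom, h2,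
      Category.id_comp, Category.comp_id]
  rw [Category.assoc (H ◁ k), sqLact_sqRcoact, reassoc_of% h3, reassoc_of% h, Category.assoc,
    Category.assoc, tensorHom_comp_tensorHom, ← id_tensorHom, ← tensorHom_id _ H,
    tensorHom_comp_tensorHom]
  simp

theorem exists_hopfSubbimodule :
    ∃ (Y : HopfBimod H) (i : Y ⟶ H₂ H) (_ : Mono i.hom),
      imageSubobject (i.hom ≫ prKer H) = Subobject.mk j.hom := by
  obtain ⟨n, hn⟩ := exists_lift_H₂ H (θInvHom j) (θInvHom_mul j)
  have hmono : Mono (θInvHom j) := by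
    have _ := IsFlat.mono_left H (j.hom ≫ kerCounitι H)
    have : Mono (θInvHom j ≫ θ H) := by rw [θInvHom_θ]; infer_instance
    exact mono_of_mono _ (θ H)
  have hn' : Mono n := by
    rw [← hn] at hmono
    exact mono_of_mono n (H₂ι H)
  have _ := IsFlat.mono_left H (H₂ι H)
  have _ := IsFlat.mono_right H (H₂ι H)
  have h₁ := θInvHom_lact j
  have h₂ := θInvHom_ract j
  have h₃ := θInvHom_lcoact j
  have h₄ := θInvHom_rcoact j
  rw [← hn] at h₁ h₂ h₃ h₄
  generalize (α_ H H M.X).inv ≫ μ ▷ M.X = l at h₁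
  generalize (H ⊗ M.X) ◁ Δ ≫ tensorμ H M.X H H ≫ (μ ⊗ₘ M.ract) = r at h₂
  generalize Δ ▷ M.X ≫ (α_ H H M.X).hom = lc at h₃
  generalize (Δ ⊗ₘ M.rcoact) ≫ tensorμ H H M.X H ≫ (H ⊗ M.X) ◁ μ = rc at h₄
  have g₁ : l ≫ n = H ◁ n ≫ (H₂ H).lact := by
    rw [← cancel_mono (H₂ι H), Category.assoc, Category.assoc, h₁, lact_H₂ι]; simp
  have g₂ : r ≫ n = n ▷ H ≫ (H₂ H).ract := by
    rw [← cancel_mono (H₂ι H), Category.assoc, Category.assoc, h₂, ract_H₂ι]; simp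
  have g₃ : lc ≫ H ◁ n = n ≫ (H₂ H).lcoact := by
    rw [← cancel_mono (H ◁ H₂ι H), Category.assoc, Category.assoc, ← H₂ι_lcoact,
      ← Category.assoc n, ← h₃]; simp
  have g₄ : rc ≫ n ▷ H = n ≫ (H₂ H).rcoact := by
    rw [← cancel_mono (H₂ι H ▷ H), Category.assoc, Category.assoc, ← H₂ι_rcoact,
      ← Category.assoc n, ← h₄]; simp
  -- All Hopf bimodule axioms for `H ⊗ M` are inherited from `Ker μ`, so only the four intertwining
  -- relations are needed.
  refine ⟨HopfBimod.ofMono (H₂ H) n (IsFlat.mono_left H) (IsFlat.mono_right H) l r lc rc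
    g₁ g₂ g₃ g₄, ⟨n, g₁, g₂, g₃.symm, g₄.symm⟩, hn', ?_⟩
  -- `θInv` commutes with `prR`, and `prR : H ⊗ M ⟶ M` is split by the unit, so the image is exactly
  -- `M`.
  have e : n ≫ prKer H = prR H M.X ≫ j.hom := by
    rw [← cancel_mono (kerCounitι H), Category.assoc, prKer_ι, reassoc_of% hn, θInvHom_prR,
      Category.assoc]
  have : Epi (prR H M.X) := by
    have h : incR H M.X ≫ prR H M.X = 𝟙 M.X := by
      rw [incR, prR, Category.assoc, ← comp_whiskerRight_assoc, BimonObj.one_counit]; simp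
    have : Epi (incR H M.X ≫ prR H M.X) := by rw [h]; infer_instance
    exact epi_of_epi (incR H M.X) _
  change imageSubobject (n ≫ prKer H) = _
  rw [e, imageSubobject_epi_comp, imageSubobject_mono]

end CoSub

/-- The crossed submodule `(ε ⊗ id)(N)` attached to a Hopf sub-bimodule `N` of `Ker μ`. -/
noncomputable def crossedOfHopf (N : HopfSubbimodule (H₂ H)) : CrossedSubmodule (kerCounit H) :=
  ⟨imageSubobject (N.1.arrow ≫ prKer H), by
    obtain ⟨N, Y, i, hi, rfl⟩ := N
    obtain ⟨M, j, hj, h⟩ := exists_crossedSubmodule i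
    exact ⟨M, j, hj, by rw [h, imageSubobject_mk_arrow_comp]⟩⟩

theorem imageSubobject_crossedOfHopf (N : HopfSubbimodule (H₂ H)) :
    imageSubobject (N.1.arrow ≫ H₂ι H ≫ θ H) =
      imageSubobject (H ◁ ((crossedOfHopf H N).1.arrow ≫ kerCounitι H)) := by
  obtain ⟨N, Y, i, hi, rfl⟩ := N
  rw [imageSubobject_mk_arrow_comp]
  have h := imageSubobject_sqHom_θ i
    ((Subobject.underlyingIso i.hom).inv ≫
      factorThruImageSubobject ((Subobject.mk i.hom).arrow ≫ prKer H))
    ((imageSubobject ((Subobject.mk i.hom).arrow ≫ prKer H)).arrow ≫ kerCounitι H) (by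
      rw [Category.assoc, imageSubobject_arrow_comp_assoc, Category.assoc, prKer_ι,
        Subobject.underlyingIso_arrow_assoc, sqHom, Category.assoc])
  simp only [sqHom, Category.assoc] at h
  exact h

theorem crossedOfHopf_bijective : Function.Bijective (crossedOfHopf H) := by
  constructor
  · intro N N' h
    have e : imageSubobject (N.1.arrow ≫ H₂ι H ≫ θ H) =
        imageSubobject (N'.1.arrow ≫ H₂ι H ≫ θ H) := by
      rw [imageSubobject_crossedOfHopf, imageSubobject_crossedOfHopf, h]
    -- Both subobjects have image `H ⊗ M` under the mono `H₂ι ≫ θ`, which forces them to be equal.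
    have := mk_eq_of_imageSubobject_comp_eq _ _ _ e
    rw [Subobject.mk_arrow, Subobject.mk_arrow] at this
    exact Subtype.ext this
  · rintro ⟨M, M', j, hj, rfl⟩
    obtain ⟨Y, i, hi, h⟩ := exists_hopfSubbimodule j
    refine ⟨⟨Subobject.mk i.hom, Y, i, hi, rfl⟩, Subtype.ext ?_⟩
    change imageSubobject ((Subobject.mk i.hom).arrow ≫ prKer H) = _
    rw [imageSubobject_mk_arrow_comp, h]

end

/-! ### Quotient Hopf bimodules. -/

section Quotient

variable {C : Type u} [Category.{v} C] [MonoidalCategory C] [BraidedCategory C]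

/-- Every action-coaction compatibility has a side of the form `(u ⊗ v) ≫ tensorμ ≫ (s ⊗ t)`; this
single naturality statement transports all four to quotients and also yields the colinearity of
`mulD`. -/
theorem tensorμ_diagonal_natural {U V U' V' A B D E A' B' D' E' F G F' G' : C}
    (u : U ⟶ A ⊗ B) (v : V ⟶ D ⊗ E) (f : U ⟶ U') (g : V ⟶ V') (u' : U' ⟶ A' ⊗ B')
    (v' : V' ⟶ D' ⊗ E') (a : A ⟶ A') (b : B ⟶ B') (d : D ⟶ D') (e : E ⟶ E')
    (s : A ⊗ D ⟶ F) (t : B ⊗ E ⟶ G) (s' : A' ⊗ D' ⟶ F') (t' : B' ⊗ E' ⟶ G')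
    (h : F ⟶ F') (k : G ⟶ G') (hu : u ≫ (a ⊗ₘ b) = f ≫ u') (hv : v ≫ (d ⊗ₘ e) = g ≫ v')
    (hs : s ≫ h = (a ⊗ₘ d) ≫ s') (ht : t ≫ k = (b ⊗ₘ e) ≫ t') :
    (u ⊗ₘ v) ≫ tensorμ A B D E ≫ (s ⊗ₘ t) ≫ (h ⊗ₘ k) =
      (f ⊗ₘ g) ≫ (u' ⊗ₘ v') ≫ tensorμ A' B' D' E' ≫ (s' ⊗ₘ t') := by
  rw [tensorHom_comp_tensorHom, hs, ht, ← tensorHom_comp_tensorHom, ← tensorμ_natural_assoc,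
    tensorHom_comp_tensorHom_assoc, hu, hv, ← tensorHom_comp_tensorHom_assoc]

/-- A quotient object of a Hopf bimodule to which all structure morphisms descend is a
Hopf bimodule, provided tensoring with `H` respects epimorphisms. -/
def HopfBimod.ofEpi {H : C} [BimonObj H] (X : HopfBimod H) {Q : C} (p : X.X ⟶ Q) [Epi p]
    (hl : ∀ {A B : C} (f : A ⟶ B) [Epi f], Epi (H ◁ f))
    (hr : ∀ {A B : C} (f : A ⟶ B) [Epi f], Epi (f ▷ H))
    (l : H ⊗ Q ⟶ Q) (r : Q ⊗ H ⟶ Q) (lc : Q ⟶ H ⊗ Q) (rc : Q ⟶ Q ⊗ H)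
    (h₁ : H ◁ p ≫ l = X.lact ≫ p) (h₂ : p ▷ H ≫ r = X.ract ≫ p)
    (h₃ : p ≫ lc = X.lcoact ≫ H ◁ p) (h₄ : p ≫ rc = X.rcoact ≫ p ▷ H) : HopfBimod H where
  X := Q
  lact := l
  ract := r
  lcoact := lc
  rcoact := rc
  one_lact := by
    have : Epi ((𝟙_ C) ◁ p) := by
      rw [MonoidalCategory.id_whiskerLeft]
      infer_instance
    rw [← cancel_epi ((𝟙_ C) ◁ p), whisker_exchange_assoc, h₁, reassoc_of% X.one_lact,
      leftUnitor_naturality]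
  mul_lact := by
    have _ := hl p
    have : Epi ((H ⊗ H) ◁ p) := by
      rw [MonoidalCategory.tensor_whiskerLeft]
      have _ := hl (H ◁ p)
      infer_instance
    rw [← cancel_epi ((H ⊗ H) ◁ p), whisker_exchange_assoc, h₁, reassoc_of% X.mul_lact,
      associator_naturality_right_assoc, ← MonoidalCategory.whiskerLeft_comp_assoc, h₁,
      MonoidalCategory.whiskerLeft_comp_assoc, h₁]
  ract_one := by
    have : Epi (p ▷ (𝟙_ C)) := by
      rw [MonoidalCategory.whiskerRight_id]
      infer_instance
    rw [← cancel_epi (p ▷ (𝟙_ C)), ← whisker_exchange_assoc, h₂, reassoc_of% X.ract_one,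
      rightUnitor_naturality]
  ract_mul := by
    have _ := hr p
    have : Epi (p ▷ (H ⊗ H)) := by
      rw [MonoidalCategory.whiskerRight_tensor]
      have _ := hr (p ▷ H)
      infer_instance
    rw [← cancel_epi (p ▷ (H ⊗ H)), ← whisker_exchange_assoc, h₂, reassoc_of% X.ract_mul,
      associator_inv_naturality_left_assoc, ← comp_whiskerRight_assoc, h₂,
      comp_whiskerRight_assoc, h₂]
  lact_ract := by
    have _ := hl p
    have _ := hr (H ◁ p)
    rw [← cancel_epi ((H ◁ p) ▷ H), ← comp_whiskerRight_assoc, h₁, comp_whiskerRight_assoc, h₂,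
      reassoc_of% X.lact_ract, associator_naturality_middle_assoc,
      ← MonoidalCategory.whiskerLeft_comp_assoc, h₂, MonoidalCategory.whiskerLeft_comp_assoc, h₁]
  lcoact_counit := by
    rw [← cancel_epi p, reassoc_of% h₃, whisker_exchange, reassoc_of% X.lcoact_counit,
      leftUnitor_inv_naturality]
  lcoact_comul := by
    rw [← cancel_epi p, reassoc_of% h₃, whisker_exchange, reassoc_of% X.lcoact_comul,
      reassoc_of% h₃, ← MonoidalCategory.whiskerLeft_comp_assoc, h₃]
    simp
  rcoact_counit := by
    rw [← cancel_epi p, reassoc_of% h₄, ← whisker_exchange, reassoc_of% X.rcoact_counit,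
      rightUnitor_inv_naturality]
  rcoact_comul := by
    rw [← cancel_epi p, reassoc_of% h₄, ← whisker_exchange, reassoc_of% X.rcoact_comul,
      reassoc_of% h₄, ← comp_whiskerRight_assoc, h₄]
    simp
  lcoact_rcoact := by
    rw [← cancel_epi p, reassoc_of% h₄, ← comp_whiskerRight, h₃, reassoc_of% h₃,
      ← MonoidalCategory.whiskerLeft_comp_assoc, h₄, comp_whiskerRight,
      reassoc_of% X.lcoact_rcoact]
    simp
  lact_lcoact := by
    have _ := hl p
    rw [← cancel_epi (H ◁ p), reassoc_of% h₁, h₃, reassoc_of% X.lact_lcoact]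
    simpa using tensorμ_diagonal_natural Δ[H] X.lcoact (𝟙 H) p Δ[H] lc (𝟙 H) (𝟙 H) (𝟙 H) p
      μ X.lact μ l (𝟙 H) p (by simp) (by simp [h₃]) (by simp) (by simp [h₁])
  ract_lcoact := by
    have _ := hr p
    rw [← cancel_epi (p ▷ H), reassoc_of% h₂, h₃, reassoc_of% X.ract_lcoact]
    simpa using tensorμ_diagonal_natural X.lcoact Δ[H] p (𝟙 H) lc Δ[H] (𝟙 H) p (𝟙 H) (𝟙 H)
      μ X.ract μ r (𝟙 H) p (by simp [h₃]) (by simp) (by simp) (by simp [h₂])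
  lact_rcoact := by
    have _ := hl p
    rw [← cancel_epi (H ◁ p), reassoc_of% h₁, h₄, reassoc_of% X.lact_rcoact]
    simpa using tensorμ_diagonal_natural Δ[H] X.rcoact (𝟙 H) p Δ[H] rc (𝟙 H) (𝟙 H) p (𝟙 H)
      X.lact μ l μ p (𝟙 H) (by simp) (by simp [h₄]) (by simp [h₁]) (by simp)
  ract_rcoact := by
    have _ := hr p
    rw [← cancel_epi (p ▷ H), reassoc_of% h₂, h₄, reassoc_of% X.ract_rcoact]
    simpa using tensorμ_diagonal_natural X.rcoact Δ[H] p (𝟙 H) rc Δ[H] p (𝟙 H) (𝟙 H) (𝟙 H)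
      X.ract μ r μ p (𝟙 H) (by simp [h₄]) (by simp) (by simp [h₂]) (by simp)

variable [Abelian C] [MonoidalPreadditive C]

theorem exists_desc_left (H : C) [IsFlat H] {A B W : C} (i : A ⟶ B) (g : H ⊗ B ⟶ W)
    (h : H ◁ i ≫ g = 0) : ∃ l : H ⊗ cokernel i ⟶ W, H ◁ cokernel.π i ≫ l = g := by
  refine ⟨(PreservesCokernel.iso (tensorLeft H) i).hom ≫ cokernel.desc ((tensorLeft H).map i) g h, ?_⟩
  have := PreservesCokernel.π_iso_hom (tensorLeft H) i
  rw [← Category.assoc]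
  erw [this]
  exact cokernel.π_desc _ _ _

theorem exists_desc_right (H : C) [IsFlat H] {A B W : C} (i : A ⟶ B) (g : B ⊗ H ⟶ W)
    (h : i ▷ H ≫ g = 0) : ∃ l : cokernel i ⊗ H ⟶ W, cokernel.π i ▷ H ≫ l = g := by
  obtain ⟨l, hl⟩ := exists_desc_left H i ((β_ B H).inv ≫ g) (by
    rw [BraidedCategory.braiding_inv_naturality_right_assoc, h, comp_zero])
  exact ⟨(β_ (cokernel i) H).hom ≫ l, by
    rw [BraidedCategory.braiding_naturality_left_assoc, hl]; simp⟩

/-- Coactions descend by the universal property of the cokernel alone; actions start from a tensor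
product, so they need `H ⊗ -` to preserve cokernels. -/
theorem HopfBimod.exists_cokernel {H : C} [BimonObj H] [IsFlat H] {Y X : HopfBimod H} (i : Y ⟶ X)
    [Mono i.hom] : ∃ (Q : HopfBimod H) (p : X ⟶ Q) (_ : Epi p.hom),
      kernelSubobject p.hom = Subobject.mk i.hom := by
  obtain ⟨l, h₁⟩ := exists_desc_left H i.hom (X.lact ≫ cokernel.π i.hom) (by
    rw [← reassoc_of% i.lact_hom, cokernel.condition, comp_zero])
  obtain ⟨r, h₂⟩ := exists_desc_right H i.hom (X.ract ≫ cokernel.π i.hom) (by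
    rw [← reassoc_of% i.ract_hom, cokernel.condition, comp_zero])
  have h₃ := cokernel.π_desc i.hom (X.lcoact ≫ H ◁ cokernel.π i.hom) (by
    rw [reassoc_of% i.hom_lcoact, ← MonoidalCategory.whiskerLeft_comp, cokernel.condition]; simp)
  have h₄ := cokernel.π_desc i.hom (X.rcoact ≫ cokernel.π i.hom ▷ H) (by
    rw [reassoc_of% i.hom_rcoact, ← comp_whiskerRight, cokernel.condition]; simp)
  refine ⟨HopfBimod.ofEpi X (cokernel.π i.hom) (IsFlat.epi_left H) (IsFlat.epi_right H)
    l r _ _ h₁ h₂ h₃ h₄, ⟨cokernel.π i.hom, h₁.symm, h₂.symm, h₃, h₄⟩,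
    inferInstanceAs (Epi (cokernel.π i.hom)), ?_⟩
  change Subobject.mk (kernel.ι (cokernel.π i.hom)) = Subobject.mk i.hom
  have e := Abelian.image.fac i.hom
  refine le_antisymm ?_ (Subobject.mk_le_mk_of_comm _ e)
  -- A mono in an abelian category is the kernel of its cokernel.
  have : IsIso (Abelian.factorThruImage i.hom) := isIso_of_mono_of_epi _
  exact Subobject.mk_le_mk_of_comm (inv (Abelian.factorThruImage i.hom))
    ((IsIso.inv_comp_eq _).2 e.symm)

end Quotient

/-! ### The universal derivation and the classification of calculi. -/

section Calculi

variable {C : Type u} [Category.{v} C] [MonoidalCategory C] [BraidedCategory C] [Abelian C]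
  [MonoidalPreadditive C]

/-- An epi is the cokernel of its kernel, which gives the map in `C`; compatibility with the
structure is tested after epis, which flatness preserves. -/
theorem HopfBimod.exists_hom_of_kernelSubobject_le {H : C} [BimonObj H] [IsFlat H]
    {X Q Q' : HopfBimod H} (p : X ⟶ Q) (p' : X ⟶ Q') [Epi p.hom]
    (h : kernelSubobject p.hom ≤ kernelSubobject p'.hom) :
    ∃ f : Q ⟶ Q', p.hom ≫ f.hom = p'.hom := by
  have hk : kernel.ι p.hom ≫ p'.hom = 0 := by
    have : kernel.ι p.hom = Subobject.ofMkLEMk _ _ h ≫ kernel.ι p'.hom :=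
      (Subobject.ofMkLEMk_comp h).symm
    rw [this, Category.assoc, kernel.condition, comp_zero]
  obtain ⟨f, hf⟩ : ∃ f : Q.X ⟶ Q'.X, p.hom ≫ f = p'.hom :=
    ⟨Abelian.epiDesc p.hom p'.hom hk, Abelian.comp_epiDesc _ _ _⟩
  have _ := IsFlat.epi_left H p.hom
  have _ := IsFlat.epi_right H p.hom
  refine ⟨⟨f, ?_, ?_, ?_, ?_⟩, hf⟩
  · rw [← cancel_epi (H ◁ p.hom), ← reassoc_of% p.lact_hom, hf, p'.lact_hom, ← hf]; simp
  · rw [← cancel_epi (p.hom ▷ H), ← reassoc_of% p.ract_hom, hf, p'.ract_hom, ← hf]; simp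
  · rw [← cancel_epi p.hom, reassoc_of% hf, p'.hom_lcoact, reassoc_of% p.hom_lcoact, ← hf]; simp
  · rw [← cancel_epi p.hom, reassoc_of% hf, p'.hom_rcoact, reassoc_of% p.hom_rcoact, ← hf]; simp

theorem whiskerLeft_sub (X : C) {A B : C} (f g : A ⟶ B) : X ◁ (f - g) = X ◁ f - X ◁ g :=
  (tensorLeft X).map_sub

theorem sub_whiskerRight (X : C) {A B : C} (f g : A ⟶ B) : (f - g) ▷ X = f ▷ X - g ▷ X :=
  (tensorRight X).map_sub

variable (H : C) [HopfObj H]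

theorem incL_mul_self : incL H H ≫ μ = 𝟙 H := by
  rw [incL, Category.assoc, MonObj.mul_one, Iso.inv_hom_id]

theorem incR_mul_self : incR H H ≫ μ = 𝟙 H := by
  rw [incR, Category.assoc, MonObj.one_mul, Iso.inv_hom_id]

theorem whiskerLeft_incL_sqLact : H ◁ incL H H ≫ sqLact H = μ ≫ incL H H := by
  rw [sqLact, incL]
  simp only [MonoidalCategory.whiskerLeft_comp, Category.assoc]
  rw [associator_inv_naturality_right_assoc, whisker_exchange, rightUnitor_inv_naturality_assoc]
  monoidal

attribute [local instance] ComonObj.instTensorUnit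

theorem isComonHom_one : IsComonHom η[H] where
  hom_counit := by simp
  hom_comul := by simp [MonObj.tensorObj.one_def]

theorem isComonHom_incR : IsComonHom (incR H H) := by
  have _ := isComonHom_one H
  have _ := HopfBimod.isComonHom_whiskerRight η[H] H
  have h := (λ_ (Comon.mk H)).inv.isComonHom_hom
  rw [Comon.monoidal_leftUnitor_inv_hom] at h
  have _ : IsComonHom (λ_ H).inv := by
    have e : (λ_ H).inv = (λ_ H).inv ≫ 𝟙 (𝟙_ C) ▷ H := by simp
    rw [e]
    exact h
  unfold incR; infer_instance

theorem isComonHom_incL : IsComonHom (incL H H) := by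
  have _ := isComonHom_one H
  have _ := HopfBimod.isComonHom_whiskerLeft η[H] H
  have h := (ρ_ (Comon.mk H)).inv.isComonHom_hom
  rw [Comon.monoidal_rightUnitor_inv_hom] at h
  have _ : IsComonHom (ρ_ H).inv := by
    have e : (ρ_ H).inv = (ρ_ H).inv ≫ H ◁ 𝟙 (𝟙_ C) := by simp
    rw [e]
    exact h
  unfold incL; infer_instance

variable {H} in
-- The coaction on `H ⊗ H` is its comultiplication followed by `μ` on one copy, so a comonoid
-- section of `μ` is colinear. `D` is the difference of two such sections, `incR` and `incL`.
theorem comp_sqLcoact (k : H ⟶ H ⊗ H) [IsComonHom k] (h : k ≫ μ = 𝟙 H) :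
    k ≫ sqLcoact H = Δ ≫ H ◁ k := by
  rw [sqLcoact, IsComonHom.hom_comul_assoc, ← tensorHom_id, tensorHom_comp_tensorHom, h,
    Category.comp_id, id_tensorHom]

variable {H} in
theorem comp_sqRcoact (k : H ⟶ H ⊗ H) [IsComonHom k] (h : k ≫ μ = 𝟙 H) :
    k ≫ sqRcoact H = Δ ≫ k ▷ H := by
  rw [sqRcoact, IsComonHom.hom_comul_assoc, ← id_tensorHom, tensorHom_comp_tensorHom, h,
    Category.comp_id, tensorHom_id]

attribute [local instance] isComonHom_incR isComonHom_incL

variable [IsFlat H]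

theorem D_H₂ι : D H ≫ H₂ι H = incR H H - incL H H := kernel.lift_ι _ _ _

/-- `g · D h = g ⊗ h - gh ⊗ 1`, and the last term dies on `Ker μ`. So `Ker μ` is generated by `D` as
a left module. -/
theorem H₂ι_D_lact : H₂ι H ≫ H ◁ D H ≫ (H₂ H).lact = 𝟙 _ := by
  rw [← cancel_mono (H₂ι H), Category.assoc, Category.assoc, lact_H₂ι,
    ← MonoidalCategory.whiskerLeft_comp_assoc, D_H₂ι, whiskerLeft_sub,
    Preadditive.sub_comp, whiskerLeft_incR_lact, whiskerLeft_incL_sqLact, Preadditive.comp_sub,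
    reassoc_of% H₂ι_mul, zero_comp]
  simp

instance : Epi (H ◁ D H ≫ (H₂ H).lact) := by
  have : Epi (H₂ι H ≫ H ◁ D H ≫ (H₂ H).lact) := by rw [H₂ι_D_lact]; infer_instance
  exact epi_of_epi (H₂ι H) _

variable {H} in
theorem hom_ext_D {X : HopfBimod H} {f g : H₂ H ⟶ X} (h : D H ≫ f.hom = D H ≫ g.hom) :
    f.hom = g.hom := by
  rw [← cancel_epi (H ◁ D H ≫ (H₂ H).lact), Category.assoc, Category.assoc, f.lact_hom,
    g.lact_hom, ← MonoidalCategory.whiskerLeft_comp_assoc, h,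
    MonoidalCategory.whiskerLeft_comp_assoc]

/-- The terms `g ⊗ h` cancel in `(1 ⊗ gh - g ⊗ h) + (g ⊗ h - gh ⊗ 1)`. -/
theorem D_leibniz : μ ≫ D H = D H ▷ H ≫ (H₂ H).ract + H ◁ D H ≫ (H₂ H).lact := by
  have e1 : incR H H ▷ H ≫ sqRact H = μ ≫ incR H H := by
    rw [sqRact, incR]
    simp only [comp_whiskerRight, Category.assoc]
    rw [associator_naturality_left_assoc, ← whisker_exchange, leftUnitor_inv_naturality_assoc]
    monoidal
  have e2 : incL H H ▷ H ≫ sqRact H = 𝟙 _ := by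
    rw [sqRact, incL, comp_whiskerRight, Category.assoc, associator_naturality_middle_assoc,
      ← MonoidalCategory.whiskerLeft_comp, MonObj.one_mul]
    monoidal
  rw [← cancel_mono (H₂ι H), Preadditive.add_comp, Category.assoc, Category.assoc, Category.assoc,
    ract_H₂ι, lact_H₂ι, ← comp_whiskerRight_assoc, ← MonoidalCategory.whiskerLeft_comp_assoc,
    D_H₂ι, whiskerLeft_sub, sub_whiskerRight,
    Preadditive.sub_comp, Preadditive.sub_comp, e1, e2, whiskerLeft_incR_lact,
    whiskerLeft_incL_sqLact, Preadditive.comp_sub]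
  abel

theorem D_lcoact : D H ≫ (H₂ H).lcoact = Δ ≫ H ◁ D H := by
  have _ := IsFlat.mono_left H (H₂ι H)
  rw [← cancel_mono (H ◁ H₂ι H), Category.assoc, ← H₂ι_lcoact, Category.assoc,
    ← MonoidalCategory.whiskerLeft_comp, D_H₂ι, reassoc_of% D_H₂ι, Preadditive.sub_comp,
    comp_sqLcoact _ (incR_mul_self H), comp_sqLcoact _ (incL_mul_self H), whiskerLeft_sub, Preadditive.comp_sub]

theorem D_rcoact : D H ≫ (H₂ H).rcoact = Δ ≫ D H ▷ H := by
  have _ := IsFlat.mono_right H (H₂ι H)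
  rw [← cancel_mono (H₂ι H ▷ H), Category.assoc, ← H₂ι_rcoact, Category.assoc,
    ← comp_whiskerRight, D_H₂ι, reassoc_of% D_H₂ι, Preadditive.sub_comp,
    comp_sqRcoact _ (incR_mul_self H), comp_sqRcoact _ (incL_mul_self H), sub_whiskerRight, Preadditive.comp_sub]

namespace BicovariantFODC

variable {H}

/-- The calculus on a quotient Hopf bimodule of `Ker μ`. -/
noncomputable def ofQuotient {Q : HopfBimod H} (p : H₂ H ⟶ Q) [Epi p.hom] :
    BicovariantFODC H where
  Ω := Q
  d := D H ≫ p.hom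
  leibniz := by
    rw [reassoc_of% D_leibniz, Preadditive.add_comp, Category.assoc, Category.assoc, p.ract_hom,
      p.lact_hom]
    simp
  generated := by
    have e : H ◁ (D H ≫ p.hom) ≫ Q.lact = (H ◁ D H ≫ (H₂ H).lact) ≫ p.hom := by
      rw [Category.assoc, p.lact_hom]; simp
    have : Epi (H ◁ (D H ≫ p.hom) ≫ Q.lact) := by rw [e]; infer_instance
    rw [← Category.comp_id (H ◁ (D H ≫ p.hom) ≫ Q.lact), imageSubobject_epi_comp,
      imageSubobject_mono]
    exact (Subobject.isIso_iff_mk_eq_top _).1 inferInstance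
  d_lcoact := by
    rw [Category.assoc, p.hom_lcoact, reassoc_of% D_lcoact]; simp
  d_rcoact := by
    rw [Category.assoc, p.hom_rcoact, reassoc_of% D_rcoact]; simp

variable (Γ : BicovariantFODC H)

/-- The Leibniz rule at `1 · 1` reads `d 1 = d 1 + d 1`. -/
theorem one_d : η ≫ Γ.d = 0 := by
  have h := congrArg (fun f => η[H] ≫ incR H H ≫ f) Γ.leibniz
  have e1 : η[H] ≫ incR H H ≫ H ◁ Γ.d ≫ Γ.Ω.lact = η ≫ Γ.d := by
    rw [incR, Category.assoc, ← whisker_exchange_assoc, Γ.Ω.one_lact,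
      ← leftUnitor_inv_naturality_assoc, Iso.inv_hom_id, Category.comp_id]
  have e2 : η[H] ≫ incR H H ≫ Γ.d ▷ H ≫ Γ.Ω.ract = η ≫ Γ.d := by
    have : η[H] ≫ incR H H = η ≫ incL H H := by
      rw [incR, incL, leftUnitor_inv_naturality_assoc, rightUnitor_inv_naturality_assoc,
        whisker_exchange, unitors_inv_equal]
    rw [reassoc_of% this, incL, Category.assoc, whisker_exchange_assoc, Γ.Ω.ract_one,
      ← rightUnitor_inv_naturality_assoc, Iso.inv_hom_id, Category.comp_id]
  simp only [Preadditive.comp_add, e1, e2, reassoc_of% incR_mul_self] at h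
  simpa using h

/-- The morphism `g ⊗ h ↦ g d(h)`. -/
def mulD : H ⊗ H ⟶ Γ.Ω.X := H ◁ Γ.d ≫ Γ.Ω.lact

theorem epi_mulD : Epi Γ.mulD := by
  have h := (Subobject.isIso_arrow_iff_eq_top _).2 Γ.generated
  have : factorThruImageSubobject (H ◁ Γ.d ≫ Γ.Ω.lact) ≫
    (imageSubobject (H ◁ Γ.d ≫ Γ.Ω.lact)).arrow = Γ.mulD := by simp [mulD]
  rw [← this]
  infer_instance

theorem mulD_lcoact : Γ.mulD ≫ Γ.Ω.lcoact = sqLcoact H ≫ H ◁ Γ.mulD := by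
  have h := tensorμ_diagonal_natural Δ[H] Δ[H] (𝟙 H) Γ.d Δ[H] Γ.Ω.lcoact (𝟙 H) (𝟙 H) (𝟙 H) Γ.d
    μ (𝟙 (H ⊗ H)) μ Γ.Ω.lact (𝟙 H) Γ.mulD (by simp) (by simp [Γ.d_lcoact]) (by simp)
    (by simp [mulD])
  rw [mulD, Category.assoc, Γ.Ω.lact_lcoact, sqLcoact, Comon.tensorObj_comul]
  simpa [mulD] using h.symm

theorem mulD_rcoact : Γ.mulD ≫ Γ.Ω.rcoact = sqRcoact H ≫ Γ.mulD ▷ H := by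
  have h := tensorμ_diagonal_natural Δ[H] Δ[H] (𝟙 H) Γ.d Δ[H] Γ.Ω.rcoact (𝟙 H) (𝟙 H) Γ.d (𝟙 H)
    (𝟙 (H ⊗ H)) μ Γ.Ω.lact μ Γ.mulD (𝟙 H) (by simp) (by simp [Γ.d_rcoact]) (by simp [mulD])
    (by simp)
  rw [mulD, Category.assoc, Γ.Ω.lact_rcoact, sqRcoact, Comon.tensorObj_comul]
  simpa [mulD] using h.symm

/-- The Hopf bimodule morphism `Ker μ ⟶ Ω` that sends the universal derivation to `d`. -/
noncomputable def proj : H₂ H ⟶ Γ.Ω where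
  hom := H₂ι H ≫ Γ.mulD
  lact_hom := by
    rw [reassoc_of% lact_H₂ι, sqLact, mulD, Category.assoc, ← whisker_exchange_assoc, Γ.Ω.mul_lact]
    simp
  ract_hom := by
    have h := congrArg (fun f => H ◁ f ≫ Γ.Ω.lact) Γ.leibniz
    simp only [MonoidalPreadditive.whiskerLeft_add, Preadditive.add_comp] at h
    -- In `g d(hk) = g d(h) k + gh d(k)` the second term vanishes on `Ker μ`; right linearity is the
    -- one property of `proj` that needs the restriction to the kernel.
    have e : H₂ι H ▷ H ≫ (α_ H H H).hom ≫ H ◁ (H ◁ Γ.d ≫ Γ.Ω.lact) ≫ Γ.Ω.lact = 0 := by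
      have : (α_ H H H).hom ≫ H ◁ (H ◁ Γ.d ≫ Γ.Ω.lact) ≫ Γ.Ω.lact =
          μ ▷ H ≫ H ◁ Γ.d ≫ Γ.Ω.lact := by
        rw [← whisker_exchange_assoc, Γ.Ω.mul_lact]; simp
      rw [this, ← comp_whiskerRight_assoc, H₂ι_mul, MonoidalPreadditive.zero_whiskerRight,
        zero_comp]
    rw [reassoc_of% ract_H₂ι, sqRact, mulD, Category.assoc,
      ← MonoidalCategory.whiskerLeft_comp_assoc, h, Preadditive.comp_add, Preadditive.comp_add, e,
      add_zero, comp_whiskerRight, comp_whiskerRight, Category.assoc, Category.assoc,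
      Γ.Ω.lact_ract]
    simp
  hom_lcoact := by
    rw [Category.assoc, mulD_lcoact, reassoc_of% H₂ι_lcoact, MonoidalCategory.whiskerLeft_comp]
  hom_rcoact := by
    rw [Category.assoc, mulD_rcoact, reassoc_of% H₂ι_rcoact, comp_whiskerRight]

theorem D_proj : D H ≫ Γ.proj.hom = Γ.d := by
  have e1 : incR H H ≫ Γ.mulD = Γ.d := by
    rw [incR, mulD, Category.assoc, ← whisker_exchange_assoc, Γ.Ω.one_lact,
      ← leftUnitor_inv_naturality_assoc, Iso.inv_hom_id, Category.comp_id]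
  have e2 : incL H H ≫ Γ.mulD = 0 := by
    rw [incL, mulD, Category.assoc, ← MonoidalCategory.whiskerLeft_comp_assoc, one_d]
    simp
  change D H ≫ H₂ι H ≫ Γ.mulD = Γ.d
  rw [reassoc_of% D_H₂ι, Preadditive.sub_comp, e1, e2, sub_zero]

instance : Epi Γ.proj.hom := by
  have e : (H ◁ D H ≫ (H₂ H).lact) ≫ Γ.proj.hom = Γ.mulD := by
    rw [Category.assoc, Γ.proj.lact_hom, ← MonoidalCategory.whiskerLeft_comp_assoc, D_proj, mulD]
  have := Γ.epi_mulD
  rw [← e] at this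
  exact epi_of_epi (H ◁ D H ≫ (H₂ H).lact) Γ.proj.hom

/-- The Hopf sub-bimodule of relations of a calculus. -/
noncomputable def relations : HopfSubbimodule (H₂ H) :=
  ⟨kernelSubobject Γ.proj.hom, HopfBimod.ker Γ.proj, HopfBimod.kerι Γ.proj,
    equalizer.ι_mono (f := Γ.proj.hom) (g := 0), rfl⟩

theorem proj_comp {Γ Γ' : BicovariantFODC H} (F : Γ ⟶ Γ') : Γ.proj.hom ≫ F.f.hom = Γ'.proj.hom :=
  hom_ext_D (f := Γ.proj ≫ F.f) (by
    rw [HopfBimod.comp_hom, reassoc_of% D_proj, F.d_f, D_proj])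

theorem relations_le {Γ Γ' : BicovariantFODC H} (F : Γ ⟶ Γ') :
    Γ.relations.1 ≤ Γ'.relations.1 := by
  have h := proj_comp F
  change kernelSubobject Γ.proj.hom ≤ kernelSubobject Γ'.proj.hom
  rw [← h]
  exact kernelSubobject_comp_le _ _

theorem exists_hom_of_relations_le {Γ Γ' : BicovariantFODC H} (h : Γ.relations.1 ≤ Γ'.relations.1) :
    ∃ F : Γ ⟶ Γ', Γ.proj.hom ≫ F.f.hom = Γ'.proj.hom := by
  obtain ⟨f, hf⟩ := HopfBimod.exists_hom_of_kernelSubobject_le Γ.proj Γ'.proj h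
  exact ⟨⟨f, by rw [← D_proj, Category.assoc, hf, D_proj]⟩, hf⟩

/-- Morphisms of calculi commute with the epis `proj`, so a calculus has no endomorphism but the
identity. -/
theorem comp_eq_id {Γ Γ' : BicovariantFODC H} (F : Γ ⟶ Γ') (G : Γ' ⟶ Γ) : F ≫ G = 𝟙 Γ := by
  have e : F.f.hom ≫ G.f.hom = 𝟙 _ := by
    rw [← cancel_epi Γ.proj.hom, reassoc_of% proj_comp F, proj_comp G, Category.comp_id]
  exact Hom.ext (HopfBimod.hom_ext e)

theorem isIsomorphic_iff {Γ Γ' : BicovariantFODC H} :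
    IsIsomorphic Γ Γ' ↔ Γ.relations = Γ'.relations := by
  constructor
  · rintro ⟨e⟩
    exact Subtype.ext (le_antisymm (relations_le e.hom) (relations_le e.inv))
  · intro h
    obtain ⟨F, -⟩ := exists_hom_of_relations_le (congrArg Subtype.val h).le
    obtain ⟨G, -⟩ := exists_hom_of_relations_le (congrArg Subtype.val h).ge
    exact ⟨⟨F, G, comp_eq_id F G, comp_eq_id G F⟩⟩

theorem relations_surjective : Function.Surjective (relations (H := H)) := by
  rintro ⟨N, Y, i, hi, rfl⟩
  obtain ⟨Q, p, hp, h⟩ := HopfBimod.exists_cokernel i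
  refine ⟨ofQuotient p, Subtype.ext ?_⟩
  -- Both send `D` to the differential of the quotient calculus, and `D` generates.
  have e : (ofQuotient p).proj.hom = p.hom :=
    hom_ext_D (f := (ofQuotient p).proj) (g := p) (D_proj (ofQuotient p))
  change kernelSubobject (ofQuotient p).proj.hom = _
  rw [e]
  exact h

variable (H) in
/-- The bijection between isomorphism classes of calculi and Hopf sub-bimodules of `Ker μ`. -/
noncomputable def relationsEquiv : IsoClass H ≃ HopfSubbimodule (H₂ H) :=
  Equiv.ofBijective
    (Quotient.lift relations fun _ _ h => isIsomorphic_iff.1 h)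
    ⟨by
      rintro ⟨Γ⟩ ⟨Γ'⟩ h
      exact Quotient.sound (isIsomorphic_iff.2 h),
    fun N => by
      obtain ⟨Γ, h⟩ := relations_surjective N
      exact ⟨⟦Γ⟧, h⟩⟩

end BicovariantFODC

end Calculi

end BraidedCalculus

open BraidedCalculus
theorem mainTheorem10 {C : Type u} [Category.{v} C] [Abelian C] [MonoidalCategory C]
    [MonoidalPreadditive C] [BraidedCategory C] [TensorFactor C]
    (H : C) [HopfObj H] [IsFlat H] [IsIso 𝒮[H]] :
    ∃ (Φ : BicovariantFODC.IsoClass H ≃ HopfSubbimodule (H₂ H))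
      (Ψ : BicovariantFODC.IsoClass H ≃ CrossedSubmodule (kerCounit H)),
      (∀ Γ : BicovariantFODC H, ∃ π : H₂ H ⟶ Γ.Ω,
        D H ≫ π.hom = Γ.d ∧ (Φ ⟦Γ⟧).1 = kernelSubobject π.hom) ∧
      (∀ c : BicovariantFODC.IsoClass H,
        imageSubobject
            ((Φ c).1.arrow ≫ (HopfBimod.kerι (HopfBimod.mulHom H)).hom ≫ θ H) =
          imageSubobject
            (H ◁ ((Ψ c).1.arrow ≫ (CrossedModule.kerι (CrossedModule.counitHom H)).hom))) :=
  -- The second bijection is the first followed by `N ↦ (ε ⊗ id)(N)`, so the final clause is `θ(N) =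
  -- H ⊗ M` for `N` the relations of the calculus.
  ⟨BicovariantFODC.relationsEquiv H,
    (BicovariantFODC.relationsEquiv H).trans
      (Equiv.ofBijective _ (crossedOfHopf_bijective H)),
    fun Γ => ⟨Γ.proj, Γ.D_proj, rfl⟩,
    fun c => imageSubobject_crossedOfHopf H (BicovariantFODC.relationsEquiv H c)⟩
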